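/- All spaces are real. For $x\in c_{00}$ (finitely supported sequences $x=(x_i)_{i\ge 1}$) and a finite set $E\subset\mathbb N=\{1,2,\dots\}$ let $Ex$ be the restriction of $x$ to $E$. Put $\|x\|_0=\max_i|x_i|$ and $$\|x\|_{m+1}=\max\Big(\|x\|_m,\ \tfrac12\sup\Big\{\sum_{j=1}^k\|E_jx\|_m \,:\, k\le E_1<E_2<\dots<E_k\Big\}\Big),\qquad \|x\|_T=\sup_m\|x\|_m ,$$ where the $E_j$ are finite subsets of $\mathbb N$; $E<E'$ means $\max E<\min E'$ and $k\le E_1$ means $k\le\min E_1$. For $1\le p<\infty$ the $p$-convexified Tsirelson space $T_{(p)}$ is the completion of $c_{00}$ under the norm $\|x\|_{(p)}=\big\|(|x_i|^p)_i\big\|_T^{1/p}$ (so $T_{(1)}=T$ is the Tsirelson space), and $T_{(p)}^*$ is its Banach dual. A Banach space $X$ has * *local unconditional structure* if there is $C\ge1$ such that for every finite-dimensional subspace $X_0\subset X$ there are a Banach space $F$ with a $1$-unconditional (finite or infinite) basis and bounded operators $u_0:X_0\to F$, $w_0:F\to X$ with $w_0u_0x=x$ for all $x\in X_0$ and $\|u_0\|\,\|w_0\|\le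 C$; * a *$2$-dimensional unconditional decomposition* if there are $2$-dimensional subspaces $Z_1,Z_2,\dots$ of $X$ such that every $x\in X$ is in a unique way the sum of a norm-convergent series $x=\sum_k z_k$ with $z_k\in Z_k$, and a constant $C$ with $\|\sum_k\varepsilon_kz_k\|\le C\|\sum_kz_k\|$ for all finite sequences $z_k\in Z_k$ and all signs $\varepsilon_k=\pm1$; * the *Gordon–Lewis property* if there is a constant $K$ such that every $1$-absolutely summing operator $v$ from $X$ into an arbitrary Banach space $Y$ factors as $v=ba$ with bounded operators $a:X\to L_1(\mu)$, $b:L_1(\mu)\to Y$ for some measure $\mu$, and, whenever $\pi_1(v)\le c$, these can be chosen with $\|a\|\,\|b\|\le K c$. Here $\pi_1(v)$ is the least $c\ge 0$ with $\sum_i\|vx_i\|\le c\,\sup_{\|f\|\le1}\sum_i|f(x_i)|$ for all finite families $(x_i)$ in $X$. **Corollary.** For every $1\le p<\infty$ the space $T_{(p)}$ contains a closed subspace, and for every $1<p<\infty$ the dual $T_{(p)}^*$ contains a closed subspace, which has no local unconditional structure but admits a $2$-dimensional unconditional decomposition and has the Gordon–Lewis property. -/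

import Mathlib

open Filter Topology

noncomputable section

/-! ### The Tsirelson norm on finitely supported sequences

Sequences are indexed by `ℕ`; the coordinate `i` plays the role of the `(i+1)`-st coordinate
of the usual indexing by `1, 2, 3, …`. -/

/-- An admissible family `k ≤ E₁ < E₂ < ⋯ < E_k` of finite sets of coordinates.
The element `i : ℕ` stands for the position `i + 1`. -/
structure AdmissibleFamily where
  k : ℕ
  sets : Fin k → Finset ℕ
  le_of_mem : ∀ j, ∀ i ∈ sets j, k ≤ i + 1
  lt_of_lt : ∀ j j', j < j' → ∀ a ∈ sets j, ∀ b ∈ sets j', a < b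

/-- The restriction `E x` of a finitely supported sequence `x` to a set `E`. -/
def restrictTo (E : Finset ℕ) (x : ℕ →₀ ℝ) : ℕ →₀ ℝ := x.filter (· ∈ E)

/-- `x ↦ max (N x) (1/2 · sup {∑ⱼ N (Eⱼ x) : k ≤ E₁ < ⋯ < E_k})`. -/
def tsirelsonStep (N : (ℕ →₀ ℝ) → ℝ) (x : ℕ →₀ ℝ) : ℝ :=
  max (N x) (1 / 2 * ⨆ E : AdmissibleFamily, ∑ j, N (restrictTo (E.sets j) x))

/-- The iterated norms `‖·‖_m` of the Figiel–Johnson construction, starting from the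
supremum norm. -/
def tsirelsonIter : ℕ → (ℕ →₀ ℝ) → ℝ
  | 0 => fun x => ⨆ i, |x i|
  | m + 1 => tsirelsonStep (tsirelsonIter m)

/-- The Tsirelson norm `‖x‖_T = sup_m ‖x‖_m` of a finitely supported sequence. -/
def tsirelsonNorm (x : ℕ →₀ ℝ) : ℝ := ⨆ m, tsirelsonIter m x

/-- The sequence `|x|^p`. -/
def absPow (p : ℝ) [Fact (1 ≤ p)] (x : ℕ →₀ ℝ) : ℕ →₀ ℝ :=
  x.mapRange (fun t => |t| ^ p) (by
    have : (1 : ℝ) ≤ p := Fact.out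
    simp [Real.zero_rpow (by linarith : p ≠ 0)])

/-- The norm of the `p`-convexification: `‖x‖_(p) = ‖ |x|^p ‖_T ^ (1/p)`. -/
def convTsirelsonNorm (p : ℝ) [Fact (1 ≤ p)] (x : ℕ →₀ ℝ) : ℝ :=
  tsirelsonNorm (absPow p x) ^ (1 / p)

/-! ### Helper facts: the functions above are norms -/

/-- The `ℓ₁` norm of a finitely supported sequence. -/
def ellOne (x : ℕ →₀ ℝ) : ℝ := ∑ i ∈ x.support, |x i|

lemma ellOne_eq {x : ℕ →₀ ℝ} {s : Finset ℕ} (h : x.support ⊆ s) :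
    ellOne x = ∑ i ∈ s, |x i| := by
  refine Finset.sum_subset h fun i _ hi => ?_
  simp [Finsupp.notMem_support_iff.mp hi]

lemma sum_ellOne_le (E : AdmissibleFamily) (x : ℕ →₀ ℝ) :
    ∑ j, ellOne (restrictTo (E.sets j) x) ≤ ellOne x := by
  have h1 : ∀ j, ellOne (restrictTo (E.sets j) x)
      = ∑ i ∈ x.support, if i ∈ E.sets j then |x i| else 0 := by
    intro j
    rw [ellOne_eq (s := x.support) (by simp [restrictTo])]
    refine Finset.sum_congr rfl fun i _ => ?_
    by_cases hi : i ∈ E.sets j <;> simp [restrictTo, hi]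
  simp_rw [h1]
  rw [Finset.sum_comm]
  refine Finset.sum_le_sum fun i _ => ?_
  by_cases hex : ∃ j, i ∈ E.sets j
  · obtain ⟨j, hj⟩ := hex
    rw [Finset.sum_eq_single j]
    · simp [hj]
    · intro b _ hb
      have : i ∉ E.sets b := by
        intro hib
        rcases lt_or_gt_of_ne hb with h | h
        · exact lt_irrefl _ (E.lt_of_lt _ _ h i hib i hj)
        · exact lt_irrefl _ (E.lt_of_lt _ _ h i hj i hib)
      simp [this]
    · simp
  · push Not at hex
    simp [hex]

/-- The properties of a lattice norm dominated by the `ℓ₁` norm which pass through the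
construction. -/
structure IsLatticeSeminorm (N : (ℕ →₀ ℝ) → ℝ) : Prop where
  nonneg : ∀ x, 0 ≤ N x
  le_ellOne : ∀ x, N x ≤ ellOne x
  add_le : ∀ x y, N (x + y) ≤ N x + N y
  smul_le : ∀ (c : ℝ) x, N (c • x) ≤ |c| * N x
  mono : ∀ x y, (∀ i, |x i| ≤ |y i|) → N x ≤ N y

lemma abs_le_ellOne (x : ℕ →₀ ℝ) (i : ℕ) : |x i| ≤ ellOne x := by
  by_cases h : i ∈ x.support
  · exact Finset.single_le_sum (f := fun i => |x i|) (fun _ _ => abs_nonneg _) h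
  · rw [Finsupp.notMem_support_iff.mp h, abs_zero]
    exact Finset.sum_nonneg fun _ _ => abs_nonneg _

lemma bddAbove_abs (x : ℕ →₀ ℝ) : BddAbove (Set.range fun i => |x i|) :=
  ⟨ellOne x, by rintro _ ⟨i, rfl⟩; exact abs_le_ellOne x i⟩

lemma isLatticeSeminorm_zero : IsLatticeSeminorm (tsirelsonIter 0) where
  nonneg x := Real.iSup_nonneg fun _ => abs_nonneg _
  le_ellOne x := ciSup_le (abs_le_ellOne x)
  add_le x y := ciSup_le fun i => (abs_add_le _ _).trans
    (add_le_add (le_ciSup (bddAbove_abs x) i) (le_ciSup (bddAbove_abs y) i))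
  smul_le c x := ciSup_le fun i => by
    simp only [Finsupp.smul_apply, smul_eq_mul, abs_mul]
    exact mul_le_mul_of_nonneg_left (le_ciSup (bddAbove_abs x) i) (abs_nonneg c)
  mono x y h := ciSup_le fun i => (h i).trans (le_ciSup (bddAbove_abs y) i)

instance : Nonempty AdmissibleFamily :=
  ⟨⟨0, fun _ => ∅, by simp, by simp⟩⟩

lemma IsLatticeSeminorm.bdd {N : (ℕ →₀ ℝ) → ℝ} (h : IsLatticeSeminorm N) (x : ℕ →₀ ℝ) :
    BddAbove (Set.range fun E : AdmissibleFamily => ∑ j, N (restrictTo (E.sets j) x)) :=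
  ⟨ellOne x, by
    rintro _ ⟨E, rfl⟩
    exact (Finset.sum_le_sum fun j _ => h.le_ellOne _).trans (sum_ellOne_le E x)⟩

lemma IsLatticeSeminorm.step {N : (ℕ →₀ ℝ) → ℝ} (h : IsLatticeSeminorm N) :
    IsLatticeSeminorm (tsirelsonStep N) where
  nonneg x := le_max_of_le_left (h.nonneg x)
  le_ellOne x := by
    have h1 : (⨆ E : AdmissibleFamily, ∑ j, N (restrictTo (E.sets j) x)) ≤ ellOne x :=
      ciSup_le fun E => (Finset.sum_le_sum fun j _ => h.le_ellOne _).trans (sum_ellOne_le E x)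
    have h2 : 0 ≤ ellOne x := (h.nonneg x).trans (h.le_ellOne x)
    exact max_le (h.le_ellOne x) (by linarith)
  add_le x y := by
    have h1 : (⨆ E : AdmissibleFamily, ∑ j, N (restrictTo (E.sets j) (x + y))) ≤
        (⨆ E : AdmissibleFamily, ∑ j, N (restrictTo (E.sets j) x)) +
        (⨆ E : AdmissibleFamily, ∑ j, N (restrictTo (E.sets j) y)) := by
      refine ciSup_le fun E => ?_
      refine le_trans ?_ (add_le_add (le_ciSup (h.bdd x) E) (le_ciSup (h.bdd y) E))
      rw [← Finset.sum_add_distrib]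
      refine Finset.sum_le_sum fun j _ => ?_
      simp only [restrictTo, Finsupp.filter_add]
      exact h.add_le _ _
    refine max_le ?_ ?_
    · exact (h.add_le x y).trans (add_le_add (le_max_left _ _) (le_max_left _ _))
    · refine le_trans ?_ (add_le_add (le_max_right _ _) (le_max_right _ _))
      linarith
  smul_le c x := by
    have h1 : (⨆ E : AdmissibleFamily, ∑ j, N (restrictTo (E.sets j) (c • x))) ≤
        |c| * (⨆ E : AdmissibleFamily, ∑ j, N (restrictTo (E.sets j) x)) := by
      refine ciSup_le fun E => ?_
      refine le_trans ?_ (mul_le_mul_of_nonneg_left (le_ciSup (h.bdd x) E) (abs_nonneg c))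
      rw [Finset.mul_sum]
      refine Finset.sum_le_sum fun j _ => ?_
      simp only [restrictTo, Finsupp.filter_smul]
      exact h.smul_le _ _
    refine max_le ?_ ?_
    · exact (h.smul_le c x).trans (mul_le_mul_of_nonneg_left (le_max_left _ _) (abs_nonneg c))
    · refine le_trans ?_ (mul_le_mul_of_nonneg_left (le_max_right _ _) (abs_nonneg c))
      linarith
  mono x y hxy := by
    refine max_le_max (h.mono x y hxy) ?_
    refine mul_le_mul_of_nonneg_left (ciSup_le fun E => ?_) (by norm_num)
    refine le_trans (Finset.sum_le_sum fun j _ => ?_) (le_ciSup (h.bdd y) E)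
    refine h.mono _ _ fun i => ?_
    by_cases hi : i ∈ E.sets j <;> simp [restrictTo, hi, hxy i]

lemma isLatticeSeminorm_iter (m : ℕ) : IsLatticeSeminorm (tsirelsonIter m) := by
  induction m with
  | zero => exact isLatticeSeminorm_zero
  | succ m ih => exact ih.step

lemma bddAbove_iter (x : ℕ →₀ ℝ) : BddAbove (Set.range fun m => tsirelsonIter m x) :=
  ⟨ellOne x, by rintro _ ⟨m, rfl⟩; exact (isLatticeSeminorm_iter m).le_ellOne x⟩

lemma isLatticeSeminorm_tsirelsonNorm : IsLatticeSeminorm tsirelsonNorm where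
  nonneg x := Real.iSup_nonneg fun m => (isLatticeSeminorm_iter m).nonneg x
  le_ellOne x := ciSup_le fun m => (isLatticeSeminorm_iter m).le_ellOne x
  add_le x y := ciSup_le fun m => ((isLatticeSeminorm_iter m).add_le x y).trans
    (add_le_add (le_ciSup (bddAbove_iter x) m) (le_ciSup (bddAbove_iter y) m))
  smul_le c x := ciSup_le fun m => ((isLatticeSeminorm_iter m).smul_le c x).trans
    (mul_le_mul_of_nonneg_left (le_ciSup (bddAbove_iter x) m) (abs_nonneg c))
  mono x y h := ciSup_le fun m => ((isLatticeSeminorm_iter m).mono x y h).trans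
    (le_ciSup (bddAbove_iter y) m)

lemma abs_le_tsirelsonNorm (x : ℕ →₀ ℝ) (i : ℕ) : |x i| ≤ tsirelsonNorm x :=
  (le_ciSup (bddAbove_abs x) i).trans (le_ciSup (bddAbove_iter x) 0)

section Convexified

variable (p : ℝ) [Fact (1 ≤ p)]

@[simp] lemma absPow_apply (x : ℕ →₀ ℝ) (i : ℕ) : absPow p x i = |x i| ^ p := rfl

lemma convTsirelsonNorm_nonneg (x : ℕ →₀ ℝ) : 0 ≤ convTsirelsonNorm p x :=
  Real.rpow_nonneg (isLatticeSeminorm_tsirelsonNorm.nonneg _) _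

lemma convTsirelsonNorm_rpow (x : ℕ →₀ ℝ) :
    convTsirelsonNorm p x ^ p = tsirelsonNorm (absPow p x) := by
  have hp : (1 : ℝ) ≤ p := Fact.out
  rw [convTsirelsonNorm, ← Real.rpow_mul (isLatticeSeminorm_tsirelsonNorm.nonneg _),
    one_div_mul_cancel (by linarith), Real.rpow_one]

lemma convTsirelsonNorm_le {x : ℕ →₀ ℝ} {r : ℝ} (hr : 0 ≤ r)
    (h : tsirelsonNorm (absPow p x) ≤ r ^ p) : convTsirelsonNorm p x ≤ r := by
  have hp : (1 : ℝ) ≤ p := Fact.out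
  rw [← convTsirelsonNorm_rpow] at h
  exact (Real.rpow_le_rpow_iff (convTsirelsonNorm_nonneg p x) hr (by linarith)).mp h

lemma abs_le_convTsirelsonNorm (x : ℕ →₀ ℝ) (i : ℕ) : |x i| ≤ convTsirelsonNorm p x := by
  have hp : (1 : ℝ) ≤ p := Fact.out
  have h := abs_le_tsirelsonNorm (absPow p x) i
  rw [← convTsirelsonNorm_rpow, absPow_apply, abs_of_nonneg (by positivity)] at h
  exact (Real.rpow_le_rpow_iff (abs_nonneg _) (convTsirelsonNorm_nonneg p x) (by linarith)).mp h

lemma convTsirelsonNorm_eq_zero {x : ℕ →₀ ℝ} (h : convTsirelsonNorm p x = 0) : x = 0 := by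
  ext i
  have := abs_le_convTsirelsonNorm p x i
  rw [h] at this
  simpa using this

lemma convTsirelsonNorm_smul_le (c : ℝ) (x : ℕ →₀ ℝ) :
    convTsirelsonNorm p (c • x) ≤ |c| * convTsirelsonNorm p x := by
  refine convTsirelsonNorm_le p (mul_nonneg (abs_nonneg c) (convTsirelsonNorm_nonneg p x)) ?_
  rw [Real.mul_rpow (abs_nonneg c) (convTsirelsonNorm_nonneg p x), convTsirelsonNorm_rpow]
  have h : absPow p (c • x) = (|c| ^ p) • absPow p x := by
    ext i
    simp [abs_mul, Real.mul_rpow (abs_nonneg c) (abs_nonneg (x i))]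
  rw [h]
  refine (isLatticeSeminorm_tsirelsonNorm.smul_le _ _).trans_eq ?_
  rw [abs_of_nonneg (by positivity)]

lemma convTsirelsonNorm_smul (c : ℝ) (x : ℕ →₀ ℝ) :
    convTsirelsonNorm p (c • x) = |c| * convTsirelsonNorm p x := by
  refine le_antisymm (convTsirelsonNorm_smul_le p c x) ?_
  by_cases hc : c = 0
  · subst hc
    simpa using convTsirelsonNorm_nonneg p 0
  · have h := convTsirelsonNorm_smul_le p c⁻¹ (c • x)
    rw [smul_smul, inv_mul_cancel₀ hc, one_smul, abs_inv] at h
    have hc' : 0 < |c| := abs_pos.mpr hc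
    calc |c| * convTsirelsonNorm p x
        ≤ |c| * (|c|⁻¹ * convTsirelsonNorm p (c • x)) := mul_le_mul_of_nonneg_left h hc'.le
      _ = convTsirelsonNorm p (c • x) := by rw [← mul_assoc, mul_inv_cancel₀ hc'.ne', one_mul]

lemma convTsirelsonNorm_add_le (x y : ℕ →₀ ℝ) :
    convTsirelsonNorm p (x + y) ≤ convTsirelsonNorm p x + convTsirelsonNorm p y := by
  have hp : (1 : ℝ) ≤ p := Fact.out
  rcases (convTsirelsonNorm_nonneg p x).eq_or_lt with hA | hA
  · have : x = 0 := convTsirelsonNorm_eq_zero p hA.symm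
    rw [← hA, this]; simp
  rcases (convTsirelsonNorm_nonneg p y).eq_or_lt with hB | hB
  · have : y = 0 := convTsirelsonNorm_eq_zero p hB.symm
    rw [← hB, this]; simp
  have hx := convTsirelsonNorm_rpow p x
  have hy := convTsirelsonNorm_rpow p y
  refine convTsirelsonNorm_le p (by linarith) ?_
  generalize convTsirelsonNorm p x = A at *
  generalize convTsirelsonNorm p y = B at *
  have hS : 0 < A + B := by linarith
  obtain ⟨t, ht⟩ : ∃ t, t = A / (A + B) := ⟨_, rfl⟩
  obtain ⟨s, hs⟩ : ∃ s, s = B / (A + B) := ⟨_, rfl⟩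
  have ht0 : 0 < t := ht ▸ div_pos hA hS
  have hs0 : 0 < s := hs ▸ div_pos hB hS
  have hts : t + s = 1 := by rw [ht, hs, ← add_div, div_self hS.ne']
  have h1 : ∀ i, |absPow p (x + y) i| ≤
      |((t * (t⁻¹) ^ p) • absPow p x + (s * (s⁻¹) ^ p) • absPow p y) i| := by
    intro i
    simp only [absPow_apply, Finsupp.add_apply, Finsupp.smul_apply, smul_eq_mul]
    rw [abs_of_nonneg (show 0 ≤ |x i + y i| ^ p by positivity)]
    refine le_trans ?_ (le_abs_self _)
    have hc := (convexOn_rpow hp).2 (x := t⁻¹ * |x i|) (y := s⁻¹ * |y i|)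
      (by simp only [Set.mem_Ici]; positivity) (by simp only [Set.mem_Ici]; positivity)
      ht0.le hs0.le hts
    simp only [smul_eq_mul] at hc
    rw [mul_inv_cancel_left₀ ht0.ne', mul_inv_cancel_left₀ hs0.ne',
      Real.mul_rpow (by positivity) (abs_nonneg _),
      Real.mul_rpow (by positivity) (abs_nonneg _), ← mul_assoc, ← mul_assoc] at hc
    exact (Real.rpow_le_rpow (abs_nonneg _) (abs_add_le _ _) (by linarith)).trans hc
  have h2 := isLatticeSeminorm_tsirelsonNorm.mono _ _ h1
  refine h2.trans ((isLatticeSeminorm_tsirelsonNorm.add_le _ _).trans ?_)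
  refine (add_le_add (isLatticeSeminorm_tsirelsonNorm.smul_le _ _)
    (isLatticeSeminorm_tsirelsonNorm.smul_le _ _)).trans_eq ?_
  rw [abs_of_nonneg (by positivity), abs_of_nonneg (by positivity), ← hx, ← hy,
    mul_assoc, mul_assoc, ← Real.mul_rpow (by positivity) hA.le,
    ← Real.mul_rpow (by positivity) hB.le]
  have e1 : t⁻¹ * A = A + B := by rw [ht]; field_simp
  have e2 : s⁻¹ * B = A + B := by rw [hs]; field_simp
  rw [e1, e2, ← add_mul, hts, one_mul]

end Convexified

/-! ### The convexified Tsirelson spaces -/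

/-- The space of finitely supported real sequences, carrying the norm `‖·‖_(p)`. -/
def PreTsirelson (_p : ℝ) : Type := ℕ →₀ ℝ

instance (p : ℝ) : AddCommGroup (PreTsirelson p) := inferInstanceAs (AddCommGroup (ℕ →₀ ℝ))

instance (p : ℝ) : Module ℝ (PreTsirelson p) := inferInstanceAs (Module ℝ (ℕ →₀ ℝ))

instance (p : ℝ) [Fact (1 ≤ p)] : Norm (PreTsirelson p) := ⟨convTsirelsonNorm p⟩

lemma preTsirelson_core (p : ℝ) [Fact (1 ≤ p)] : NormedSpace.Core ℝ (PreTsirelson p) where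
  norm_nonneg x := convTsirelsonNorm_nonneg p x
  norm_smul c x := convTsirelsonNorm_smul p c x
  norm_triangle x y := convTsirelsonNorm_add_le p x y
  norm_eq_zero_iff x := by
    refine ⟨fun h => convTsirelsonNorm_eq_zero p h, ?_⟩
    rintro rfl
    have h : convTsirelsonNorm p 0 = 0 := by
      simpa using convTsirelsonNorm_smul p 0 0
    exact h

instance (p : ℝ) [Fact (1 ≤ p)] : NormedAddCommGroup (PreTsirelson p) :=
  NormedAddCommGroup.ofCore (preTsirelson_core p)

instance (p : ℝ) [Fact (1 ≤ p)] : NormedSpace ℝ (PreTsirelson p) :=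
  NormedSpace.ofCore (preTsirelson_core p)

/-- The `p`-convexified Tsirelson space `T_(p)`: the completion of the finitely supported
sequences under `‖·‖_(p)`.  For `p = 1` this is the Tsirelson space `T` itself. -/
abbrev ConvTsirelson (p : ℝ) [Fact (1 ≤ p)] : Type := UniformSpace.Completion (PreTsirelson p)

/-! ### Unconditional structure -/

/-- A Schauder decomposition: a sequence of closed subspaces `Z k` such that every `x` has a
unique expansion `x = ∑ z k` (norm-convergent series) with `z k ∈ Z k`. -/
structure IsSchauderDecomposition {X : Type*} [NormedAddCommGroup X] [NormedSpace ℝ X]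
    (Z : ℕ → Submodule ℝ X) : Prop where
  isClosed : ∀ k, IsClosed (Z k : Set X)
  existsUnique : ∀ x : X, ∃! z : ℕ → X, (∀ k, z k ∈ Z k) ∧
    Tendsto (fun n => ∑ k ∈ Finset.range n, z k) atTop (𝓝 x)

/-- `X` admits a `d`-dimensional unconditional decomposition: a Schauder decomposition into
`d`-dimensional subspaces which is `C`-unconditional for some `C`. -/
def HasUnconditionalDecomposition (d : ℕ) (X : Type*) [NormedAddCommGroup X]
    [NormedSpace ℝ X] : Prop :=
  ∃ Z : ℕ → Submodule ℝ X, IsSchauderDecomposition Z ∧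
    (∀ k, FiniteDimensional ℝ (Z k) ∧ Module.finrank ℝ (Z k) = d) ∧
    ∃ C : ℝ, ∀ (s : Finset ℕ) (z : ℕ → X) (ε : ℕ → ℝ), (∀ k, z k ∈ Z k) →
      (∀ k, ε k = 1 ∨ ε k = -1) → ‖∑ k ∈ s, ε k • z k‖ ≤ C * ‖∑ k ∈ s, z k‖

/-- The normed space `F` has a (finite or infinite) `1`-unconditional basis. -/
def HasOneUnconditionalBasis (F : Type*) [NormedAddCommGroup F] [NormedSpace ℝ F] : Prop :=
  ∃ (ι : Type) (_ : Countable ι) (b : UnconditionalSchauderBasis ι ℝ F),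
    ∀ (s : Finset ι) (t ε : ι → ℝ), (∀ j, ε j = 1 ∨ ε j = -1) →
      ‖∑ j ∈ s, (ε j * t j) • b j‖ ≤ ‖∑ j ∈ s, t j • b j‖

universe u

/-- Local unconditional structure: for some `C ≥ 1`, the inclusion of every finite-dimensional
subspace `X₀` of `X` factors as `X₀ → F → X` through a Banach space `F` with a `1`-unconditional
basis, with `‖u₀‖ ‖w₀‖ ≤ C`. -/
def HasLocalUnconditionalStructure (X : Type u) [NormedAddCommGroup X] [NormedSpace ℝ X] :
    Prop :=
  ∃ C : ℝ, 1 ≤ C ∧ ∀ X₀ : Submodule ℝ X, FiniteDimensional ℝ X₀ →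
    ∃ (F : Type u) (_ : NormedAddCommGroup F) (_ : NormedSpace ℝ F) (_ : CompleteSpace F),
      HasOneUnconditionalBasis F ∧
      ∃ (u₀ : X₀ →L[ℝ] F) (w₀ : F →L[ℝ] X), (∀ x : X₀, w₀ (u₀ x) = x) ∧ ‖u₀‖ * ‖w₀‖ ≤ C

/-- `v` is `1`-absolutely summing with `π₁(v) ≤ c`:
`∑ᵢ ‖v xᵢ‖ ≤ c · sup {∑ᵢ |f xᵢ| : ‖f‖ ≤ 1}` for all finite families `(xᵢ)`.
(The supremum is finite, as it is at most `∑ᵢ ‖xᵢ‖`.) -/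
def IsOneSummingWith {X Y : Type*} [NormedAddCommGroup X] [NormedSpace ℝ X]
    [NormedAddCommGroup Y] [NormedSpace ℝ Y] (c : ℝ) (v : X →L[ℝ] Y) : Prop :=
  0 ≤ c ∧ ∀ (n : ℕ) (x : Fin n → X),
    ∑ i, ‖v (x i)‖ ≤ c * ⨆ f : {f : StrongDual ℝ X // ‖f‖ ≤ 1}, ∑ i, |f.1 (x i)|

/-- The Gordon–Lewis property: there is `K` such that every `1`-absolutely summing operator
`v : X → Y` into an arbitrary Banach space `Y` factors as `X → L₁(μ) → Y`, `v = b ∘ a`, with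
`‖a‖ ‖b‖ ≤ K π₁(v)`. -/
def HasGordonLewisProperty (X : Type u) [NormedAddCommGroup X] [NormedSpace ℝ X] : Prop :=
  ∃ K : ℝ, ∀ (Y : Type u) [NormedAddCommGroup Y] [NormedSpace ℝ Y] [CompleteSpace Y]
    (v : X →L[ℝ] Y) (c : ℝ), IsOneSummingWith c v →
    ∃ (Ω : Type u) (_ : MeasurableSpace Ω) (μ : MeasureTheory.Measure Ω)
      (a : X →L[ℝ] MeasureTheory.Lp ℝ 1 μ) (b : MeasureTheory.Lp ℝ 1 μ →L[ℝ] Y),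
      v = b ∘L a ∧ ‖a‖ * ‖b‖ ≤ K * c

end

/-!
The subspaces are spanned by suitable sequences of planes, each of which lies in the span of three
vectors of a `1`-unconditional basic sequence: the basis of `T_(p)`, or in its dual the sequence of
the biorthogonal functionals.

*The subspaces.* Fix three linear forms `x`, `y`, `x - y` on the plane `ℝ²`, any two of which are
independent, and three weighted families of basis vectors with disjoint ranges, indexed by the same
set. The `k`-th plane consists of the vectors whose coordinates at the `k`-th members of the three
families are the values of the three forms (`planeSeq`). As the basis is `1`-unconditional,
the closed span `Y` of the planes has the planes as a `2`-dimensional unconditional decomposition.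
Such a decomposition into spaces of bounded dimension gives the Gordon–Lewis property
(`IsPlaneSystem.hasGordonLewisProperty`): if `v` is `1`-summing, the norms of the images under `v`
of the components of a vector are summable, and on each plane `v` factors with a uniform constant
through a two-dimensional `ℓ₁`, so that `v` factors through the `ℓ₁` sum of these.

*No local unconditional structure.* Suppose that the identity on a finite sum of planes factors as
`w u` through a space with a `1`-unconditional basis. The compression of the factorization to one
plane writes the identity of the plane, which has trace `2`, as a sum of operators of rank one, one
for each basis vector of the lattice. An operator of rank one with large trace cannot leave all
three kernels of the forms almost invariant (`abs_trace_le`), so that after a change of signs on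
the lattice the compression moves one of the three kernels by a definite amount. The signs may be
chosen separately for each plane: by Khinchine's inequality in the lattice and its dual the
resulting block diagonal operator is bounded by a constant which does not depend on the number of
planes (`HasLocalUnconditionalStructure.exists_diagonal`). Now label each plane by the kernel
which is moved. Applied to a vector `∑ t k • e k`, where `e k` spans the `i`-th kernel in the
`k`-th plane and `t` is supported by planes with label `i`, the operator turns a vector without
coordinates in the `i`-th family into one whose coordinates there are at least of the order of
`t`. This is impossible if for every labelling there are `i` and `t` for which the `i`-th family
dominates the other two, that is, if the families compete (`HasCompetingFamilies`,
`exists_subspace_of_competingFamilies`).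

*The competing families.* The Tsirelson norm is equivalent to the `ℓ₁` norm on `n` coordinates
beyond `n`, but no sequence of its basis vectors spans `ℓ₁`: every sequence of coordinates carries
convex combinations of arbitrarily small norm
(`exists_convex_tsirelsonNorm_mapDomain_le`). Accordingly the index set can be divided into rows so
that the first family (number `0`) is `ℓ₁` everywhere, the second one is `ℓ₁` on each row but small
on suitable vectors on each section, that is, on each choice of one index from each row, and the
third one is small on suitable vectors on each row and each section (`TsirelsonRows`). Given one
of the three labels for a single point, one for a row and one for a section, a labelling uses the
first at some point, or the second on a whole row, or the third on a section. In `T_(p)` these are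
the labels `2`, `1` and `0`: with a suitable weight for each family, the third family dominates on
single vectors, the second one on rows, where the third one is small, and the first one on
sections, where the two others are small. In the dual, where the vectors which are small in `T_(p)`
give large functionals, they are the labels `0`, `2` and `1`; here the weights of the third family
decrease from row to row, so that it does not count on sections.
-/

noncomputable section

/-! ### The Tsirelson norm -/

lemma tsirelsonIter_mono (x : ℕ →₀ ℝ) : Monotone fun m => tsirelsonIter m x :=
  monotone_nat_of_le_succ fun _ => le_max_left _ _

lemma tsirelsonIter_le_norm (m : ℕ) (x : ℕ →₀ ℝ) : tsirelsonIter m x ≤ tsirelsonNorm x :=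
  le_ciSup (bddAbove_iter x) m

lemma tsirelsonNorm_nonneg (x : ℕ →₀ ℝ) : 0 ≤ tsirelsonNorm x :=
  isLatticeSeminorm_tsirelsonNorm.nonneg x

/-- One half of the implicit equation of the Tsirelson norm: its lower bound for sums over
admissible families. -/
lemma sum_tsirelsonNorm_restrictTo_le (E : AdmissibleFamily) (x : ℕ →₀ ℝ) :
    ∑ j, tsirelsonNorm (restrictTo (E.sets j) x) ≤ 2 * tsirelsonNorm x := by
  have hlim : Tendsto (fun m => ∑ j, tsirelsonIter m (restrictTo (E.sets j) x)) atTop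
      (𝓝 (∑ j, tsirelsonNorm (restrictTo (E.sets j) x))) :=
    tendsto_finsetSum _ fun j _ =>
      tendsto_atTop_ciSup (tsirelsonIter_mono _) (bddAbove_iter _)
  refine le_of_tendsto' hlim fun m => ?_
  have h1 := le_ciSup ((isLatticeSeminorm_iter m).bdd x) E
  have h2 := tsirelsonIter_le_norm (m + 1) x
  have h3 := le_max_right (tsirelsonIter m x)
    (1 / 2 * ⨆ E : AdmissibleFamily, ∑ j, tsirelsonIter m (restrictTo (E.sets j) x))
  have h4 : max (tsirelsonIter m x)
    (1 / 2 * ⨆ E : AdmissibleFamily, ∑ j, tsirelsonIter m (restrictTo (E.sets j) x))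
      = tsirelsonIter (m + 1) x := rfl
  rw [h4] at h3
  linarith

/-- The other half of the implicit equation of the Tsirelson norm: an upper bound for all
coordinates and all sums over admissible families bounds the norm. -/
lemma tsirelsonNorm_le {x : ℕ →₀ ℝ} {C : ℝ} (h0 : ∀ i, |x i| ≤ C)
    (h : ∀ E : AdmissibleFamily, ∑ j, tsirelsonNorm (restrictTo (E.sets j) x) ≤ 2 * C) :
    tsirelsonNorm x ≤ C := by
  refine ciSup_le fun m => ?_
  induction m with
  | zero => exact ciSup_le h0
  | succ m ih =>
    refine max_le ih ?_
    have : (⨆ E : AdmissibleFamily, ∑ j, tsirelsonIter m (restrictTo (E.sets j) x)) ≤ 2 * C :=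
      ciSup_le fun E => (Finset.sum_le_sum fun j _ => tsirelsonIter_le_norm _ _).trans (h E)
    linarith

/-- On `n` coordinates which all lie beyond `n` the Tsirelson norm is equivalent to the `ℓ₁`
norm. -/
lemma sum_abs_le_two_mul_tsirelsonNorm (S : Finset ℕ) (hS : ∀ n ∈ S, S.card ≤ n + 1)
    (x : ℕ →₀ ℝ) : ∑ n ∈ S, |x n| ≤ 2 * tsirelsonNorm x := by
  let E : AdmissibleFamily :=
    { k := S.card
      sets := fun j => {S.orderEmbOfFin rfl j}
      le_of_mem := by
        intro j i hi
        rw [Finset.mem_singleton] at hi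
        subst hi
        exact hS _ (Finset.orderEmbOfFin_mem S rfl j)
      lt_of_lt := by
        intro j j' hj a ha b hb
        rw [Finset.mem_singleton] at ha hb
        subst ha hb
        exact (S.orderEmbOfFin rfl).strictMono hj }
  refine le_trans ?_ (sum_tsirelsonNorm_restrictTo_le E x)
  have h1 : ∑ n ∈ S, |x n| = ∑ j : Fin S.card, |x (S.orderEmbOfFin rfl j)| := by
    rw [← Finset.sum_coe_sort]
    exact (Fintype.sum_equiv (S.orderIsoOfFin rfl).toEquiv _ _ fun j => rfl).symm
  rw [h1]
  refine Finset.sum_le_sum fun j _ => ?_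
  refine le_trans (le_of_eq ?_) (abs_le_tsirelsonNorm _ (S.orderEmbOfFin rfl j))
  simp [restrictTo, E]

lemma restrictTo_mapDomain {α : Type*} {g : α → ℕ} (hg : Function.Injective g) (E : Finset ℕ)
    (t : α →₀ ℝ) :
    restrictTo E (t.mapDomain g) = (t.filter (g · ∈ E)).mapDomain g := by
  ext i
  by_cases hi : i ∈ Set.range g
  · obtain ⟨a, rfl⟩ := hi
    simp only [restrictTo, Finsupp.filter_apply, Finsupp.mapDomain_apply hg]
  · rw [Finsupp.mapDomain_of_notMem_range _ _ hi, restrictTo]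
    by_cases ha : i ∈ E
    · rw [Finsupp.filter_apply_pos _ _ ha, Finsupp.mapDomain_of_notMem_range _ _ hi]
    · rw [Finsupp.filter_apply_neg _ _ ha]

/-- Moving the coordinates of a vector to the right, without changing their order, does not
decrease its Tsirelson norm. -/
lemma tsirelsonNorm_mapDomain_le {n m : ℕ → ℕ} (hn : StrictMono n) (hm : StrictMono m)
    (h : ∀ i, n i ≤ m i) (t : ℕ →₀ ℝ) :
    tsirelsonNorm (t.mapDomain n) ≤ tsirelsonNorm (t.mapDomain m) := by
  have key : ∀ r (t : ℕ →₀ ℝ),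
      tsirelsonIter r (t.mapDomain n) ≤ tsirelsonIter r (t.mapDomain m) := by
    intro r
    induction r with
    | zero =>
      intro t
      refine ciSup_le fun i => ?_
      by_cases hi : i ∈ Set.range n
      · obtain ⟨a, rfl⟩ := hi
        rw [Finsupp.mapDomain_apply hn.injective]
        have := le_ciSup (bddAbove_abs (t.mapDomain m)) (m a)
        simp only [Finsupp.mapDomain_apply hm.injective] at this
        exact this
      · rw [Finsupp.mapDomain_of_notMem_range _ _ hi, abs_zero]
        exact isLatticeSeminorm_zero.nonneg _
    | succ r ih =>
      intro t
      refine max_le_max (ih t) (mul_le_mul_of_nonneg_left (ciSup_le fun E => ?_) (by norm_num))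
      let E' : AdmissibleFamily :=
        { k := E.k
          sets := fun j => (t.support.filter (n · ∈ E.sets j)).image m
          le_of_mem := by
            intro j i hi
            obtain ⟨a, ha, rfl⟩ := Finset.mem_image.mp hi
            have := E.le_of_mem j _ (Finset.mem_filter.mp ha).2
            have := h a
            omega
          lt_of_lt := by
            intro j j' hj a ha b hb
            obtain ⟨a, ha', rfl⟩ := Finset.mem_image.mp ha
            obtain ⟨b, hb', rfl⟩ := Finset.mem_image.mp hb
            exact hm (hn.lt_iff_lt.mp (E.lt_of_lt j j' hj _ (Finset.mem_filter.mp ha').2 _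
              (Finset.mem_filter.mp hb').2)) }
      refine le_trans ?_ (le_ciSup ((isLatticeSeminorm_iter r).bdd _) E')
      change ∑ j : Fin E.k, _ ≤ ∑ j : Fin E.k, _
      refine Finset.sum_le_sum fun j _ => ?_
      rw [restrictTo_mapDomain hn.injective, restrictTo_mapDomain hm.injective]
      refine (ih _).trans_eq ?_
      congr 2
      ext a
      have hiff : t a ≠ 0 → (m a ∈ E'.sets j ↔ n a ∈ E.sets j) := by
        intro hne
        refine ⟨fun hc => ?_, fun ha => Finset.mem_image_of_mem _
          (Finset.mem_filter.mpr ⟨Finsupp.mem_support_iff.mpr hne, ha⟩)⟩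
        obtain ⟨b, hb, hba⟩ := Finset.mem_image.mp hc
        rw [hm.injective hba] at hb
        exact (Finset.mem_filter.mp hb).2
      by_cases hne : t a = 0
      · simp [Finsupp.filter_apply, hne]
      · simp only [Finsupp.filter_apply, hiff hne]
  exact ciSup_le fun r => (key r t).trans (tsirelsonIter_le_norm _ _)

lemma tsirelsonNorm_sum_le {ι : Type*} (s : Finset ι) (x : ι → ℕ →₀ ℝ) :
    tsirelsonNorm (∑ i ∈ s, x i) ≤ ∑ i ∈ s, tsirelsonNorm (x i) := by
  classical
  induction s using Finset.induction_on with
  | empty =>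
    have := isLatticeSeminorm_tsirelsonNorm.le_ellOne 0
    simpa [ellOne] using this
  | insert a s ha ih =>
    rw [Finset.sum_insert ha, Finset.sum_insert ha]
    exact (isLatticeSeminorm_tsirelsonNorm.add_le _ _).trans (by linarith)

/-- An admissible family of `k` sets acts on a successive sequence of vectors as if all but `k`
of the vectors met only one of the sets. -/
lemma sum_sum_restrictTo_le {c : ℝ} {n : ℕ} {u : ℕ → ℕ →₀ ℝ} (hc : 0 ≤ c)
    (hu : ∀ i, tsirelsonNorm (u i) ≤ c)
    (hsucc : ∀ i i', i < i' → ∀ a ∈ (u i).support, ∀ b ∈ (u i').support, a < b)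
    (E : AdmissibleFamily) :
    ∑ i ∈ Finset.range n, ∑ j, tsirelsonNorm (restrictTo (E.sets j) (u i)) ≤
      n * c + E.k * (2 * c) := by
  classical
  let bad : ℕ → Prop := fun i => ∃ j j' : Fin E.k, j < j' ∧
    (∃ a ∈ (u i).support, a ∈ E.sets j) ∧ (∃ a ∈ (u i).support, a ∈ E.sets j')
  have h1 : ∀ i, ∑ j, tsirelsonNorm (restrictTo (E.sets j) (u i)) ≤
      c + if bad i then 2 * c else 0 := by
    intro i
    by_cases hb : bad i
    · rw [if_pos hb]
      have := sum_tsirelsonNorm_restrictTo_le E (u i)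
      linarith [hu i]
    · rw [if_neg hb, add_zero]
      have hz : ∀ j, (¬ ∃ a ∈ (u i).support, a ∈ E.sets j) →
          tsirelsonNorm (restrictTo (E.sets j) (u i)) = 0 := by
        intro j hj
        have : restrictTo (E.sets j) (u i) = 0 := by
          ext a
          simp only [restrictTo, Finsupp.filter_apply, Finsupp.coe_zero, Pi.zero_apply]
          split_ifs with ha
          · by_contra hne
            exact hj ⟨a, Finsupp.mem_support_iff.mpr hne, ha⟩
          · rfl
        rw [this]
        simpa using tsirelsonNorm_sum_le (∅ : Finset ℕ) (fun _ => 0) |>.antisymm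
          (by simpa using tsirelsonNorm_nonneg 0)
      by_cases hex : ∃ j, ∃ a ∈ (u i).support, a ∈ E.sets j
      · obtain ⟨j, hj⟩ := hex
        rw [Finset.sum_eq_single j]
        · refine le_trans (isLatticeSeminorm_tsirelsonNorm.mono _ _ fun a => ?_) (hu i)
          simp only [restrictTo, Finsupp.filter_apply]
          split_ifs <;> simp
        · intro j' _ hne
          refine hz j' fun hj' => hb ?_
          rcases lt_or_gt_of_ne hne with h | h
          · exact ⟨j', j, h, hj', hj⟩
          · exact ⟨j, j', h, hj, hj'⟩
        · simp
      · push Not at hex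
        rw [Finset.sum_eq_zero fun j _ => hz j (by push Not; exact hex j)]
        exact hc
  refine (Finset.sum_le_sum fun i _ => h1 i).trans ?_
  rw [Finset.sum_add_distrib, Finset.sum_const, Finset.card_range, nsmul_eq_mul,
    ← Finset.sum_filter, Finset.sum_const, nsmul_eq_mul]
  have h2 : ((Finset.range n).filter bad).card ≤ E.k := by
    have hex : ∀ i, ∃ j : ℕ, bad i → ∃ (hj : j < E.k) (j' : Fin E.k), (⟨j, hj⟩ : Fin E.k) < j' ∧
        (∃ a ∈ (u i).support, a ∈ E.sets ⟨j, hj⟩) ∧ (∃ a ∈ (u i).support, a ∈ E.sets j') := by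
      intro i
      by_cases hb : bad i
      · obtain ⟨j, j', h⟩ := hb
        exact ⟨j, fun _ => ⟨j.2, j', h⟩⟩
      · exact ⟨0, fun h => absurd h hb⟩
    choose g hg using hex
    have hlt : ∀ i i', i < i' → bad i → bad i' → g i ≠ g i' := by
      intro i i' hii hi hi' heq
      obtain ⟨hj, j', hjj, -, b, hb, hbE⟩ := hg i hi
      obtain ⟨hj2, -, -, ⟨a, ha, haE⟩, -⟩ := hg i' hi'
      have e : (⟨g i, hj⟩ : Fin E.k) = ⟨g i', hj2⟩ := Fin.ext heq
      rw [← e] at haE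
      have h3 := E.lt_of_lt _ _ hjj a haE b hbE
      have h4 := hsucc i i' hii b hb a ha
      omega
    calc ((Finset.range n).filter bad).card ≤ (Finset.range E.k).card := by
          refine Finset.card_le_card_of_injOn g ?_ ?_
          · intro i hi
            have hi' := (Finset.mem_filter.mp (Finset.mem_coe.mp hi)).2
            obtain ⟨hj, -⟩ := hg i hi'
            simpa using hj
          · intro i hi i' hi' heq
            have h5 := (Finset.mem_filter.mp (Finset.mem_coe.mp hi)).2
            have h6 := (Finset.mem_filter.mp (Finset.mem_coe.mp hi')).2
            by_contra hne
            rcases lt_or_gt_of_ne hne with h | h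
            · exact hlt i i' h h5 h6 heq
            · exact hlt i' i h h6 h5 heq.symm
      _ = E.k := Finset.card_range _
  have h3 : (((Finset.range n).filter bad).card : ℝ) ≤ E.k := by exact_mod_cast h2
  have := mul_le_mul_of_nonneg_right h3 (by linarith : 0 ≤ 2 * c)
  linarith

/-- The sum of the coordinates of a finitely supported function. -/
def coordSum (α : Type*) : (α →₀ ℝ) →ₗ[ℝ] ℝ := Finsupp.linearCombination ℝ fun _ => 1

lemma coordSum_eq {α : Type*} {x : α →₀ ℝ} {s : Finset α} (h : x.support ⊆ s) :
    coordSum α x = ∑ i ∈ s, x i := by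
  rw [coordSum, Finsupp.linearCombination_apply, Finsupp.sum_of_support_subset _ h _ (by simp)]
  simp

lemma coordSum_mapDomain {α β : Type*} (g : α → β) (x : α →₀ ℝ) :
    coordSum β (x.mapDomain g) = coordSum α x := by
  rw [coordSum, Finsupp.linearCombination_mapDomain]
  rfl

/-- The step in the proof that block sequences of the Tsirelson basis are not equivalent to the
`ℓ₁` basis: from convex vectors of norm at most `c` one gets convex vectors of norm at most
`4/5 · c`, namely the mean of one vector and of a long average of successive ones. -/
lemma exists_convex_tsirelsonNorm_le_step {A : Set ℕ} {c : ℝ} (hc : 0 ≤ c)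
    (h : ∀ m, ∃ x : ℕ →₀ ℝ, (∀ i, 0 ≤ x i) ∧ (∀ i ∈ x.support, i ∈ A ∧ m ≤ i) ∧
      coordSum ℕ x = 1 ∧ tsirelsonNorm x ≤ c) (m : ℕ) :
    ∃ x : ℕ →₀ ℝ, (∀ i, 0 ≤ x i) ∧ (∀ i ∈ x.support, i ∈ A ∧ m ≤ i) ∧
      coordSum ℕ x = 1 ∧ tsirelsonNorm x ≤ 4 / 5 * c := by
  choose v hv0 hvs hv1 hvc using h
  have hT := isLatticeSeminorm_tsirelsonNorm
  -- `s i` is a bound for the supports of the vectors before the `i`-th one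
  obtain ⟨s, hs0, hs⟩ : ∃ s : ℕ → ℕ, s 0 = m ∧
      ∀ i, s (i + 1) = max (s i) ((v (s i)).support.sup id + 1) :=
    ⟨fun i => Nat.rec m (fun _ a => max a ((v a).support.sup id + 1)) i, rfl, fun _ => rfl⟩
  have hsm : Monotone s := monotone_nat_of_le_succ fun i => by rw [hs]; exact le_max_left _ _
  let u : ℕ → ℕ →₀ ℝ := fun i => v (s i)
  have hlt : ∀ i, ∀ a ∈ (u i).support, a < s (i + 1) := by
    intro i a ha
    have : a ≤ (v (s i)).support.sup id := Finset.le_sup (f := id) ha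
    rw [hs]
    omega
  have hge : ∀ i, ∀ a ∈ (u i).support, s i ≤ a := fun i a ha => (hvs _ a ha).2
  have hsucc : ∀ i i', i < i' → ∀ a ∈ (u i).support, ∀ b ∈ (u i').support, a < b :=
    fun i i' hi a ha b hb => (hlt i a ha).trans_le ((hsm hi).trans (hge i' b hb))
  obtain ⟨n, hn⟩ : ∃ n : ℕ, n = 10 * s 1 + 1 := ⟨_, rfl⟩
  have hn0 : (0 : ℝ) < n := by rw [hn]; positivity
  have hns : 10 * (s 1 : ℝ) ≤ n := by rw [hn]; push_cast; linarith
  let y : ℕ →₀ ℝ := (n : ℝ)⁻¹ • ∑ i ∈ Finset.range n, u (i + 1)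
  have hy : ∀ a, y a = (n : ℝ)⁻¹ * ∑ i ∈ Finset.range n, u (i + 1) a := by
    intro a
    simp [y]
  have hy0 : ∀ a, a < s 1 → y a = 0 := by
    intro a ha
    rw [hy, Finset.sum_eq_zero, mul_zero]
    intro i _
    by_contra hne
    have h1 := hge (i + 1) a (Finsupp.mem_support_iff.mpr hne)
    have h2 := hsm (Nat.le_add_left 1 i)
    omega
  have hu0 : ∀ a, s 1 ≤ a → u 0 a = 0 := by
    intro a ha
    by_contra hne
    have h1 := hlt 0 a (Finsupp.mem_support_iff.mpr hne)
    simp only [zero_add] at h1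
    omega
  have hyN : tsirelsonNorm y ≤ c := by
    refine (hT.smul_le _ _).trans ?_
    rw [abs_of_pos (inv_pos.mpr hn0)]
    calc (n : ℝ)⁻¹ * tsirelsonNorm (∑ i ∈ Finset.range n, u (i + 1))
        ≤ (n : ℝ)⁻¹ * (n * c) := by
          refine mul_le_mul_of_nonneg_left ((tsirelsonNorm_sum_le _ _).trans ?_)
            (inv_pos.mpr hn0).le
          refine (Finset.sum_le_sum fun i _ => hvc _).trans_eq ?_
          simp
      _ = c := inv_mul_cancel_left₀ hn0.ne' c
  have hx : ∀ a, ((1 / 2 : ℝ) • (u 0 + y)) a = 1 / 2 * (u 0 a + y a) := by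
    intro a
    simp [mul_add]
  refine ⟨(1 / 2 : ℝ) • (u 0 + y), ?_, ?_, ?_, ?_⟩
  · intro a
    rw [hx, hy]
    have := Finset.sum_nonneg fun i (_ : i ∈ Finset.range n) => hv0 (s (i + 1)) a
    have := hv0 (s 0) a
    positivity
  · intro a ha
    rw [Finsupp.mem_support_iff, hx] at ha
    have : ∃ i, u i a ≠ 0 := by
      by_contra hne
      push Not at hne
      exact ha (by rw [hy]; simp [hne])
    obtain ⟨i, hi⟩ := this
    have hi' := hvs _ a (Finsupp.mem_support_iff.mpr hi)
    exact ⟨hi'.1, hs0 ▸ (hsm (Nat.zero_le i)).trans hi'.2⟩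
  · simp only [y, u, map_smul, map_add, map_sum, hv1]
    simp only [Finset.sum_const, Finset.card_range, smul_eq_mul, nsmul_eq_mul, mul_one]
    rw [inv_mul_cancel₀ hn0.ne']
    norm_num
  · refine tsirelsonNorm_le (fun a => ?_) fun E => ?_
    · rw [hx, abs_mul, abs_of_pos (by norm_num : (0 : ℝ) < 1 / 2)]
      rcases lt_or_ge a (s 1) with ha | ha
      · rw [hy0 a ha, add_zero]
        have := (abs_le_tsirelsonNorm (u 0) a).trans (hvc _)
        linarith
      · rw [hu0 a ha, zero_add]
        have := (abs_le_tsirelsonNorm y a).trans hyN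
        linarith
    · have hE : ∀ j, restrictTo (E.sets j) ((1 / 2 : ℝ) • (u 0 + y)) =
          (1 / 2 : ℝ) • (restrictTo (E.sets j) (u 0) + restrictTo (E.sets j) y) := by
        intro j
        simp only [restrictTo, Finsupp.filter_smul, Finsupp.filter_add]
      have hsum : ∑ j, tsirelsonNorm (restrictTo (E.sets j) ((1 / 2 : ℝ) • (u 0 + y))) ≤
          1 / 2 * (∑ j, tsirelsonNorm (restrictTo (E.sets j) (u 0)) +
            ∑ j, tsirelsonNorm (restrictTo (E.sets j) y)) := by
        rw [← Finset.sum_add_distrib, Finset.mul_sum]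
        refine Finset.sum_le_sum fun j _ => ?_
        rw [hE]
        refine (hT.smul_le _ _).trans ?_
        rw [abs_of_pos (by norm_num : (0 : ℝ) < 1 / 2)]
        exact mul_le_mul_of_nonneg_left (hT.add_le _ _) (by norm_num)
      refine hsum.trans ?_
      rcases le_or_gt E.k (s 1) with hk | hk
      · have h1 := (sum_tsirelsonNorm_restrictTo_le E (u 0)).trans
          (mul_le_mul_of_nonneg_left (hvc (s 0)) zero_le_two)
        have h2 : ∑ j, tsirelsonNorm (restrictTo (E.sets j) y) ≤
            (n : ℝ)⁻¹ * (n * c + E.k * (2 * c)) := by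
          refine le_trans ?_ (mul_le_mul_of_nonneg_left
            (sum_sum_restrictTo_le (n := n) (u := fun i => u (i + 1)) hc (fun i => hvc _)
              (fun i i' hi => hsucc (i + 1) (i' + 1) (by omega)) E) (inv_pos.mpr hn0).le)
          rw [Finset.sum_comm, Finset.mul_sum]
          refine Finset.sum_le_sum fun j _ => ?_
          have : restrictTo (E.sets j) y =
              (n : ℝ)⁻¹ • ∑ i ∈ Finset.range n, restrictTo (E.sets j) (u (i + 1)) := by
            simp only [y, restrictTo, Finsupp.filter_smul]
            congr 1
            exact map_sum (Finsupp.filterAddHom (· ∈ E.sets j)) _ _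
          rw [this]
          refine (hT.smul_le _ _).trans ?_
          rw [abs_of_pos (inv_pos.mpr hn0)]
          exact mul_le_mul_of_nonneg_left (tsirelsonNorm_sum_le _ _) (inv_pos.mpr hn0).le
        have h3 : (n : ℝ)⁻¹ * (n * c + E.k * (2 * c)) ≤ 6 / 5 * c := by
          rw [inv_mul_le_iff₀ hn0]
          have hk' : (E.k : ℝ) ≤ s 1 := by exact_mod_cast hk
          nlinarith
        linarith
      · have h1 : ∑ j, tsirelsonNorm (restrictTo (E.sets j) (u 0)) = 0 := by
          refine Finset.sum_eq_zero fun j _ => ?_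
          have : restrictTo (E.sets j) (u 0) = 0 := by
            ext a
            simp only [restrictTo, Finsupp.filter_apply, Finsupp.coe_zero, Pi.zero_apply]
            split_ifs with ha
            · have := E.le_of_mem j a ha
              exact hu0 a (by omega)
            · rfl
          rw [this]
          exact le_antisymm (by simpa using tsirelsonNorm_sum_le (∅ : Finset ℕ) (fun _ => 0))
            (tsirelsonNorm_nonneg 0)
        have h2 := sum_tsirelsonNorm_restrictTo_le E y
        linarith

/-- No subsequence of the Tsirelson basis is equivalent to the `ℓ₁` basis: there are convex
combinations of arbitrarily small norm. -/
lemma exists_convex_tsirelsonNorm_mapDomain_le {n : ℕ → ℕ} (hn : StrictMono n) {ε : ℝ}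
    (hε : 0 < ε) :
    ∃ t : ℕ →₀ ℝ, (∀ i, 0 ≤ t i) ∧ coordSum ℕ t = 1 ∧ tsirelsonNorm (t.mapDomain n) ≤ ε := by
  have key : ∀ r m : ℕ, ∃ x : ℕ →₀ ℝ, (∀ i, 0 ≤ x i) ∧
      (∀ i ∈ x.support, i ∈ Set.range n ∧ m ≤ i) ∧
      coordSum ℕ x = 1 ∧ tsirelsonNorm x ≤ (4 / 5) ^ r := by
    intro r
    induction r with
    | zero =>
      intro m
      have h1 : coordSum ℕ (Finsupp.single (n m) 1) = 1 := by simp [coordSum]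
      refine ⟨Finsupp.single (n m) 1, fun i => ?_, fun i hi => ?_, h1, ?_⟩
      · rw [Finsupp.single_apply]; split_ifs <;> norm_num
      · rw [Finset.mem_singleton.mp (Finsupp.support_single_subset hi)]
        exact ⟨⟨m, rfl⟩, hn.id_le m⟩
      · refine (isLatticeSeminorm_tsirelsonNorm.le_ellOne _).trans ?_
        rw [ellOne_eq (s := {n m}) Finsupp.support_single_subset]
        simp
    | succ r ih =>
      rw [pow_succ']
      exact exists_convex_tsirelsonNorm_le_step (by positivity) ih
  obtain ⟨r, hr⟩ := exists_pow_lt_of_lt_one hε (by norm_num : (4 / 5 : ℝ) < 1)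
  obtain ⟨x, hx0, hxs, hx1, hxN⟩ := key r 0
  have hmap := Finsupp.mapDomain_comapDomain n hn.injective x fun i hi => (hxs i hi).1
  refine ⟨x.comapDomain n hn.injective.injOn, fun i => hx0 _, ?_, ?_⟩
  · rw [← coordSum_mapDomain n, hmap, hx1]
  · rw [hmap]
    exact hxN.trans hr.le

/-! ### Rows and columns of coordinates -/

section Spread

variable {ι : Type*} [Fintype ι]

/-- The finitely supported sequence with the entries `t k` at the positions `g k`. -/
def spread (g : ι → ℕ) (t : ι → ℝ) : ℕ →₀ ℝ := ∑ k, Finsupp.single (g k) (t k)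

lemma spread_apply {g : ι → ℕ} (hg : Function.Injective g) (t : ι → ℝ) (k : ι) :
    spread g t (g k) = t k := by
  classical
  rw [spread, Finsupp.finsetSum_apply, Finset.sum_eq_single k]
  · simp
  · intro b _ hb
    exact Finsupp.single_eq_of_ne (fun h => hb (hg h.symm))
  · simp

lemma spread_apply_of_notMem {g : ι → ℕ} (t : ι → ℝ) {n : ℕ} (h : ∀ k, g k ≠ n) :
    spread g t n = 0 := by
  rw [spread, Finsupp.finsetSum_apply]
  exact Finset.sum_eq_zero fun k _ => Finsupp.single_eq_of_ne (fun hk => h k hk.symm)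

lemma tsirelsonNorm_spread_le (g : ι → ℕ) (t : ι → ℝ) :
    tsirelsonNorm (spread g t) ≤ ∑ k, |t k| := by
  refine (tsirelsonNorm_sum_le _ _).trans (Finset.sum_le_sum fun k _ => ?_)
  refine (isLatticeSeminorm_tsirelsonNorm.le_ellOne _).trans ?_
  rw [ellOne_eq (s := {g k}) Finsupp.support_single_subset]
  simp

lemma sum_abs_le_two_mul_tsirelsonNorm_spread {g : ι → ℕ} (hg : Function.Injective g)
    (t : ι → ℝ) (T : Finset ι) (hT : ∀ k, k ∉ T → t k = 0) (hc : ∀ k ∈ T, T.card ≤ g k + 1) :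
    ∑ k, |t k| ≤ 2 * tsirelsonNorm (spread g t) := by
  classical
  refine le_trans (le_of_eq ?_) (sum_abs_le_two_mul_tsirelsonNorm (T.image g) ?_ _)
  · rw [Finset.sum_image fun a _ b _ h => hg h]
    simp_rw [spread_apply hg]
    exact (Finset.sum_subset (Finset.subset_univ T) fun k _ hk => by simp [hT k hk]).symm
  · intro n hn
    obtain ⟨k, hk, rfl⟩ := Finset.mem_image.mp hn
    exact Finset.card_image_le.trans (hc k hk)

end Spread

/-- Three families of basis vectors of the Tsirelson space, indexed by the same finite set `ι`
which is divided into rows.  With respect to nonnegative coefficients of sum `1`: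
the family `2` is small on suitable vectors supported by a row, where the families `1` and `0`
behave like `ℓ₁`; the families `2` and `1` are small on suitable vectors supported by any set
which meets each row in one point, while the family `0` behaves like `ℓ₁` everywhere. -/
structure TsirelsonRows (M : ℕ) (ε : ℕ → ℝ) (δ : ℝ) where
  ι : Type
  [fintype : Fintype ι]
  pos : Fin 3 → ι → ℕ
  rows : ℕ
  rows_pos : 0 < rows
  row : ι → ℕ
  row_lt : ∀ k, row k < rows
  injective : Function.Injective fun x : Fin 3 × ι => pos x.1 x.2
  le_pos : ∀ i k, M ≤ pos i k
  exists_row : ∀ j < rows, ∃ r : ι → ℝ, (∀ k, 0 ≤ r k) ∧ (∀ k, row k ≠ j → r k = 0) ∧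
    ∑ k, r k = 1 ∧ tsirelsonNorm (spread (pos 2) r) ≤ ε j
  row_large : ∀ j, ∀ r : ι → ℝ, (∀ k, row k ≠ j → r k = 0) →
    ∑ k, |r k| ≤ 2 * tsirelsonNorm (spread (pos 1) r)
  exists_col : ∀ s : ℕ → ι, (∀ j < rows, row (s j) = j) → ∃ r : ι → ℝ, (∀ k, 0 ≤ r k) ∧
    (∀ k, k ≠ s (row k) → r k = 0) ∧ ∑ k, r k = 1 ∧
    tsirelsonNorm (spread (pos 1) r) ≤ δ ∧ tsirelsonNorm (spread (pos 2) r) ≤ δ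
  large : ∀ r : ι → ℝ, ∑ k, |r k| ≤ 2 * tsirelsonNorm (spread (pos 0) r)

attribute [instance] TsirelsonRows.fintype

lemma exists_convex_tsirelsonNorm_shift_le (m : ℕ) {ε : ℝ} (hε : 0 < ε) :
    ∃ (n : ℕ) (t : ℕ → ℝ), 0 < n ∧ (∀ i, 0 ≤ t i) ∧ ∑ s : Fin n, t s = 1 ∧
      tsirelsonNorm (spread (fun s : Fin n => m + s) fun s => t s) ≤ ε := by
  have hmono : StrictMono fun i : ℕ => m + i := fun a b h => by simpa using h
  obtain ⟨t, ht0, ht1, htN⟩ := exists_convex_tsirelsonNorm_mapDomain_le hmono hε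
  have hsub : t.support ⊆ Finset.range (t.support.sup id + 1) := fun i hi => by
    have : i ≤ t.support.sup id := Finset.le_sup (f := id) hi
    rw [Finset.mem_range]
    omega
  refine ⟨t.support.sup id + 1, t, Nat.succ_pos _, ht0, ?_, ?_⟩
  · rw [← ht1, coordSum_eq hsub, Finset.sum_range]
  · convert htN
    rw [spread, Finsupp.mapDomain, Finsupp.sum_of_support_subset _ hsub _ (by simp),
      Finset.sum_range]

/-- The rows of the families `2` and `1` are placed in successive intervals. As the norm increases
when coordinates are moved to the right, a convex combination which is small on the sequence of
the right ends of the intervals is small on every section. The family `0` is placed beyond all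
rows. -/
theorem nonempty_tsirelsonRows (M : ℕ) {ε : ℕ → ℝ} {δ : ℝ} (hε : ∀ j, 0 < ε j) (hδ : 0 < δ) :
    Nonempty (TsirelsonRows M ε δ) := by
  classical
  choose len t hlen ht0 ht1 htN using fun m j => exists_convex_tsirelsonNorm_shift_le m (hε j)
  -- row `j` occupies the positions from `b j` to `b (j + 1)`: the first half for the family `2`,
  -- the second half for the family `1`
  obtain ⟨b, hb0, hb⟩ : ∃ b : ℕ → ℕ, b 0 = M ∧ ∀ j, b (j + 1) = b j + 2 * len (b j) j :=
    ⟨fun i => Nat.rec M (fun j a => a + 2 * len a j) i, rfl, fun _ => rfl⟩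
  obtain ⟨l, hl⟩ : ∃ l : ℕ → ℕ, ∀ j, l j = len (b j) j := ⟨_, fun _ => rfl⟩
  have ht1' : ∀ j, ∑ s : Fin (l j), t (b j) j s = 1 := fun j => by
    rw [hl]
    exact ht1 _ _
  have htN' : ∀ j, tsirelsonNorm (spread (fun s : Fin (l j) => b j + s) fun s => t (b j) j s) ≤
      ε j := fun j => by
    rw [hl]
    exact htN _ _
  have hl0 : ∀ j, 0 < l j := fun j => hl j ▸ hlen _ _
  have hb' : ∀ j, b (j + 1) = b j + 2 * l j := fun j => by rw [hb, hl]
  have hbm : StrictMono b := strictMono_nat_of_lt_succ fun j => by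
    have := hl0 j
    rw [hb']
    omega
  -- a sequence is strictly increasing if its `j`-th term lies in the `j`-th interval
  have hmono : ∀ n : ℕ → ℕ, (∀ j, b j ≤ n j ∧ n j < b (j + 1)) → StrictMono n :=
    fun n hn => strictMono_nat_of_lt_succ fun j => (hn j).2.trans_le (hn (j + 1)).1
  have hend : ∀ j, b j ≤ b (j + 1) - 1 ∧ b (j + 1) - 1 < b (j + 1) := fun j => by
    have := hl0 j
    have := hb' j
    omega
  obtain ⟨τ, hτ0, hτ1, hτN⟩ := exists_convex_tsirelsonNorm_mapDomain_le (hmono _ hend) hδ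
  let R := τ.support.sup id + 1
  have hsub : τ.support ⊆ Finset.range R := fun i hi => by
    have : i ≤ τ.support.sup id := Finset.le_sup (f := id) hi
    rw [Finset.mem_range]
    exact Nat.lt_succ_of_le this
  let ι := Σ j : Fin R, Fin (l j)
  let pos : Fin 3 → ι → ℕ := ![fun k => b R + (b k.1 + k.2), fun k => b k.1 + l k.1 + k.2,
    fun k => b k.1 + k.2]
  let row : ι → ℕ := fun k => k.1
  have hlt : ∀ k : ι, b k.1 + (l k.1 + k.2) < b (k.1 + 1) := fun k => by
    have := k.2.2
    rw [hb']
    omega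
  have hltR : ∀ k : ι, b (k.1 + 1) ≤ b R := fun k => hbm.monotone k.1.2
  have hrow : ∀ k k' : ι, ∀ x, b k.1 ≤ x → x < b (k.1 + 1) → b k'.1 ≤ x → x < b (k'.1 + 1) →
      k.1 = k'.1 := by
    intro k k' x h1 h2 h3 h4
    have h5 := hbm.lt_iff_lt.mp (h1.trans_lt h4)
    have h6 := hbm.lt_iff_lt.mp (h3.trans_lt h2)
    exact Fin.ext (by omega)
  have hinj : Function.Injective fun x : Fin 3 × ι => pos x.1 x.2 := by
    rintro ⟨i, ⟨j, s⟩⟩ ⟨i', ⟨j', s'⟩⟩ h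
    have a1 := hlt ⟨j, s⟩
    have a2 := hlt ⟨j', s'⟩
    have a3 := hltR ⟨j, s⟩
    have a4 := hltR ⟨j', s'⟩
    have a5 := s.2
    have a6 := s'.2
    have hj : j = j' := by
      refine hrow ⟨j, s⟩ ⟨j', s'⟩ (if i = 0 then b j + s else pos i ⟨j, s⟩) ?_ ?_ ?_ ?_ <;>
      fin_cases i <;> fin_cases i' <;> simp [pos] at h a1 a2 a3 a4 ⊢ <;> omega
    subst hj
    have hs : i = i' ∧ (s : ℕ) = s' := by
      fin_cases i <;> fin_cases i' <;> simp [pos] at h a1 a2 a3 a4 ⊢ <;> omega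
    rw [hs.1, Fin.ext hs.2]
  have hinj' : ∀ i, Function.Injective (pos i) := fun i a a' h =>
    congrArg Prod.snd (hinj (a₁ := (i, a)) (a₂ := (i, a')) h)
  have hbM : ∀ j, M ≤ b j := fun j => hb0 ▸ hbm.monotone (Nat.zero_le j)
  have hcard : Fintype.card ι ≤ b R := by
    have : ∀ r, ∑ j ∈ Finset.range r, l j ≤ b r := by
      intro r
      induction r with
      | zero => simp
      | succ r ih =>
        rw [Finset.sum_range_succ, hb']
        omega
    refine le_trans (le_of_eq ?_) (this R)
    simp [ι, Finset.sum_range]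
  -- vectors supported by one point of each row
  have hcol : ∀ (s : ℕ → ι) (_ : ∀ j < R, row (s j) = j) (V : Type) [AddCommMonoid V]
      (F : ι → V), (∀ k, k ≠ s (row k) → F k = 0) → ∑ k, F k = ∑ j ∈ Finset.range R, F (s j) := by
    intro s hs V _ F hF
    have h1 : ∑ k, F k = ∑ k ∈ Finset.univ.filter fun k => k = s (row k), F k :=
      (Finset.sum_subset (Finset.subset_univ _) fun k _ hk => hF k (by simpa using hk)).symm
    rw [h1]
    refine Finset.sum_nbij' row s ?_ ?_ ?_ ?_ ?_
    · intro k _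
      exact Finset.mem_range.mpr k.1.2
    · intro j hj
      have := hs j (Finset.mem_range.mp hj)
      simp [this]
    · intro k hk
      exact (Finset.mem_filter.mp hk).2.symm
    · intro j hj
      exact hs j (Finset.mem_range.mp hj)
    · intro k hk
      rw [← (Finset.mem_filter.mp hk).2]
  refine ⟨⟨ι, pos, R, Nat.succ_pos _, row, fun k => k.1.2, hinj, ?_, ?_, ?_, ?_, ?_⟩⟩
  · intro i k
    have := hbM k.1
    fin_cases i <;> simp [pos] <;> omega
  · intro j hj
    let r : ι → ℝ := fun k => if row k = j then t (b j) j k.2 else 0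
    have hsum : ∀ (V : Type) [AddCommMonoid V] (F : ι → V), (∀ k, row k ≠ j → F k = 0) →
        ∑ k, F k = ∑ s : Fin (l j), F ⟨⟨j, hj⟩, s⟩ := by
      intro V _ F hF
      rw [Fintype.sum_sigma, Finset.sum_eq_single (⟨j, hj⟩ : Fin R)]
      · intro j' _ hne
        exact Finset.sum_eq_zero fun s _ => hF _ fun h => hne (Fin.ext h)
      · simp
    have hr : ∀ k, row k ≠ j → r k = 0 := fun k hk => if_neg hk
    refine ⟨r, fun k => ?_, hr, ?_, ?_⟩
    · simp only [r]
      split_ifs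
      · exact ht0 _ _ _
      · exact le_rfl
    · rw [hsum ℝ r hr]
      simp only [r, row, if_true]
      exact ht1' j
    · refine le_trans (le_of_eq ?_) (htN' j)
      rw [spread, hsum _ _ fun k hk => by rw [hr k hk, Finsupp.single_zero], spread]
      simp only [r, row, if_true, pos]
      rfl
  · intro j r hr
    refine sum_abs_le_two_mul_tsirelsonNorm_spread (hinj' 1) r
      (Finset.univ.filter fun k => row k = j) (fun k hk => hr k (by simpa using hk)) ?_
    intro k hk
    have hk' : row k = j := (Finset.mem_filter.mp hk).2
    have : (Finset.univ.filter fun k => row k = j).card ≤ l j := by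
      calc _ ≤ (Finset.range (l j)).card := by
            refine Finset.card_le_card_of_injOn (fun k => (k.2 : ℕ)) ?_ ?_
            · intro k hk
              have h1 : row k = j := (Finset.mem_filter.mp (Finset.mem_coe.mp hk)).2
              simp only [row] at h1
              simp [← h1]
            · rintro ⟨j1, s1⟩ h1 ⟨j2, s2⟩ h2 h
              have h3 := (Finset.mem_filter.mp (Finset.mem_coe.mp h1)).2
              have h4 := (Finset.mem_filter.mp (Finset.mem_coe.mp h2)).2
              simp only [row] at h3 h4
              have h5 : j1 = j2 := Fin.ext (h3.trans h4.symm)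
              subst h5
              rw [show s1 = s2 from Fin.ext h]
        _ = l j := Finset.card_range _
    subst hk'
    refine this.trans ?_
    simp [pos, row]
    omega
  · intro s hs
    let r : ι → ℝ := fun k => if k = s (row k) then τ (row k) else 0
    have hr : ∀ k, k ≠ s (row k) → r k = 0 := fun k hk => if_neg hk
    have hrs : ∀ j < R, r (s j) = τ j := by
      intro j hj
      simp only [r, hs j hj, if_true]
    have hN : ∀ g : ι → ℕ, (∀ k, b k.1 ≤ g k ∧ g k < b (k.1 + 1)) →
        tsirelsonNorm (spread g r) ≤ δ := by
      intro g hg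
      let n : ℕ → ℕ := fun j => if j < R then g (s j) else b (j + 1) - 1
      have hn : ∀ j, b j ≤ n j ∧ n j < b (j + 1) := by
        intro j
        by_cases hj : j < R
        · have h1 := hg (s j)
          have h2 : ((s j).1 : ℕ) = j := hs j hj
          rw [h2] at h1
          simpa [n, hj] using h1
        · simpa [n, hj] using hend j
      refine le_trans (le_of_eq ?_) ((tsirelsonNorm_mapDomain_le (hmono n hn) (hmono _ hend)
        (fun j => Nat.le_sub_one_of_lt (hn j).2) τ).trans hτN)
      rw [spread, hcol s hs _ _ fun k hk => by rw [hr k hk, Finsupp.single_zero],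
        Finsupp.mapDomain, Finsupp.sum_of_support_subset _ hsub _ (by simp)]
      congr 1
      refine Finset.sum_congr rfl fun j hj => ?_
      have hj' := Finset.mem_range.mp hj
      rw [hrs j hj']
      simp [n, hj']
    refine ⟨r, fun k => ?_, hr, ?_, hN _ fun k => ?_, hN _ fun k => ?_⟩
    · simp only [r]
      split_ifs
      · exact hτ0 _
      · exact le_rfl
    · rw [hcol s hs ℝ r hr, ← hτ1, coordSum_eq hsub]
      exact Finset.sum_congr rfl fun j hj => hrs j (Finset.mem_range.mp hj)
    · have := hlt k
      simp [pos]
      omega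
    · have := hlt k
      simp [pos]
      omega
  · intro r
    refine sum_abs_le_two_mul_tsirelsonNorm_spread (hinj' 0) r Finset.univ (by simp) ?_
    intro k _
    rw [Finset.card_univ]
    refine hcard.trans ?_
    simp [pos]
    omega

/-! ### Khinchine's inequality -/

/-- The sign `1` on `U` and `-1` off `U`. -/
def signOn (U : Finset ℕ) (k : ℕ) : ℝ := if k ∈ U then 1 else -1

lemma abs_signOn (U : Finset ℕ) (k : ℕ) : |signOn U k| = 1 := by
  unfold signOn
  split_ifs <;> simp

lemma sum_powerset_insert_signOn {a : ℕ} {S : Finset ℕ} (ha : a ∉ S) (A : ℕ → ℝ) (φ : ℝ → ℝ) :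
    ∑ U ∈ (insert a S).powerset, φ (∑ k ∈ insert a S, signOn U k * A k) =
      ∑ U ∈ S.powerset, (φ (∑ k ∈ S, signOn U k * A k - A a) +
        φ (∑ k ∈ S, signOn U k * A k + A a)) := by
  rw [Finset.sum_powerset_insert ha, Finset.sum_add_distrib]
  congr 1
  · refine Finset.sum_congr rfl fun U hU => ?_
    have : a ∉ U := fun h => ha (Finset.mem_powerset.mp hU h)
    rw [Finset.sum_insert ha]
    congr 1
    simp only [signOn, if_neg this]
    ring
  · refine Finset.sum_congr rfl fun U _ => ?_
    rw [Finset.sum_insert ha]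
    congr 1
    have h1 : signOn (insert a U) a = 1 := if_pos (Finset.mem_insert_self a U)
    have h2 : ∑ k ∈ S, signOn (insert a U) k * A k = ∑ k ∈ S, signOn U k * A k := by
      refine Finset.sum_congr rfl fun k hk => ?_
      have : k ≠ a := fun h => ha (h ▸ hk)
      simp [signOn, Finset.mem_insert, this]
    rw [h1, h2]
    ring

lemma sum_signOn_sq (S : Finset ℕ) (A : ℕ → ℝ) :
    ∑ U ∈ S.powerset, (∑ k ∈ S, signOn U k * A k) ^ 2 = 2 ^ S.card * ∑ k ∈ S, A k ^ 2 := by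
  induction S using Finset.induction_on with
  | empty => simp
  | insert a S ha ih =>
    rw [sum_powerset_insert_signOn ha A (· ^ 2)]
    have : ∀ x : ℝ, (x - A a) ^ 2 + (x + A a) ^ 2 = 2 * x ^ 2 + 2 * A a ^ 2 := fun x => by ring
    simp_rw [this]
    rw [Finset.sum_add_distrib, ← Finset.mul_sum, ih, Finset.sum_const, Finset.card_powerset,
      Finset.card_insert_of_notMem ha, Finset.sum_insert ha, nsmul_eq_mul]
    push_cast
    ring

lemma sum_signOn_pow_four_le (S : Finset ℕ) (A : ℕ → ℝ) :
    ∑ U ∈ S.powerset, (∑ k ∈ S, signOn U k * A k) ^ 4 ≤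
      2 ^ S.card * (3 * (∑ k ∈ S, A k ^ 2) ^ 2) := by
  induction S using Finset.induction_on with
  | empty => simp
  | insert a S ha ih =>
    rw [sum_powerset_insert_signOn ha A (· ^ 4)]
    have : ∀ x : ℝ, (x - A a) ^ 4 + (x + A a) ^ 4 =
        2 * x ^ 4 + 12 * A a ^ 2 * x ^ 2 + 2 * A a ^ 4 := fun x => by ring
    simp_rw [this]
    rw [Finset.sum_add_distrib, Finset.sum_add_distrib, ← Finset.mul_sum, ← Finset.mul_sum,
      sum_signOn_sq, Finset.sum_const, Finset.card_powerset,
      Finset.card_insert_of_notMem ha, Finset.sum_insert ha, nsmul_eq_mul]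
    push_cast
    have h2 : (0 : ℝ) < 2 ^ S.card := by positivity
    have h3 : (0 : ℝ) ≤ 2 ^ S.card * A a ^ 4 := by positivity
    rw [pow_succ (2 : ℝ)]
    nlinarith

/-- Khinchine's inequality between the `L₂` and `L₁` norms, with constant `2`. -/
lemma sqrt_sum_sq_le (S : Finset ℕ) (A : ℕ → ℝ) :
    2 ^ S.card * √(∑ k ∈ S, A k ^ 2) ≤ 2 * ∑ U ∈ S.powerset, |∑ k ∈ S, signOn U k * A k| := by
  obtain ⟨s, hs⟩ : ∃ s, s = √(∑ k ∈ S, A k ^ 2) := ⟨_, rfl⟩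
  have h0 : 0 ≤ ∑ k ∈ S, A k ^ 2 := Finset.sum_nonneg fun _ _ => sq_nonneg _
  have hs2 : s ^ 2 = ∑ k ∈ S, A k ^ 2 := by rw [hs, Real.sq_sqrt h0]
  have hs0 : 0 ≤ s := hs ▸ Real.sqrt_nonneg _
  rw [← hs]
  rcases hs0.eq_or_lt with h | hpos
  · rw [← h, mul_zero]
    exact mul_nonneg zero_le_two (Finset.sum_nonneg fun _ _ => abs_nonneg _)
  have h2 := sum_signOn_sq S A
  have h4 := sum_signOn_pow_four_le S A
  rw [← hs2] at h2 h4
  -- `x² / s - x⁴ / (12 s³) ≤ 4/3 · |x|`, that is, `(y - 2)² (y + 4) ≥ 0` for `y = |x| / s`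
  have key : ∀ x : ℝ, 12 * s ^ 2 * x ^ 2 - x ^ 4 ≤ 16 * s ^ 3 * |x| := by
    intro x
    rw [← sq_abs x, show x ^ 4 = |x| ^ 4 by
      rw [← abs_pow, abs_of_nonneg (by positivity)]]
    have h5 := abs_nonneg x
    generalize |x| = y at *
    have h6 : 0 ≤ y * ((y - 2 * s) ^ 2 * (y + 4 * s)) := by positivity
    nlinarith
  have hsum := Finset.sum_le_sum fun U (_ : U ∈ S.powerset) => key (∑ k ∈ S, signOn U k * A k)
  rw [Finset.sum_sub_distrib, ← Finset.mul_sum, ← Finset.mul_sum, h2] at hsum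
  have h7 : 9 * s ^ 3 * (2 ^ S.card * s) ≤
      16 * s ^ 3 * ∑ U ∈ S.powerset, |∑ k ∈ S, signOn U k * A k| := by
    refine le_trans ?_ hsum
    nlinarith
  have h8 : 9 * (2 ^ S.card * s) ≤ 16 * ∑ U ∈ S.powerset, |∑ k ∈ S, signOn U k * A k| := by
    have h9 : 0 < s ^ 3 := by positivity
    refine le_of_mul_le_mul_left ?_ h9
    linarith
  have h10 : 0 ≤ ∑ U ∈ S.powerset, |∑ k ∈ S, signOn U k * A k| :=
    Finset.sum_nonneg fun _ _ => abs_nonneg _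
  linarith

/-- Khinchine's inequality for two sequences, combined with the Cauchy–Schwarz inequality. -/
lemma sum_abs_mul_abs_le (S : Finset ℕ) (A B : ℕ → ℝ) :
    4 ^ S.card * ∑ k ∈ S, |A k| * |B k| ≤ 4 * ∑ U ∈ S.powerset, ∑ V ∈ S.powerset,
      |∑ k ∈ S, signOn U k * A k| * |∑ k ∈ S, signOn V k * B k| := by
  have h1 := Real.sum_mul_le_sqrt_mul_sqrt S (fun k => |A k|) (fun k => |B k|)
  simp only [sq_abs] at h1
  have hA := sqrt_sum_sq_le S A
  have hB := sqrt_sum_sq_le S B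
  rw [← Finset.sum_mul_sum]
  have hA0 := Real.sqrt_nonneg (∑ k ∈ S, A k ^ 2)
  have hB0 := Real.sqrt_nonneg (∑ k ∈ S, B k ^ 2)
  have h2 : (4 : ℝ) ^ S.card = 2 ^ S.card * 2 ^ S.card := by
    rw [← mul_pow]
    norm_num
  calc 4 ^ S.card * ∑ k ∈ S, |A k| * |B k|
      ≤ 4 ^ S.card * (√(∑ k ∈ S, A k ^ 2) * √(∑ k ∈ S, B k ^ 2)) :=
        mul_le_mul_of_nonneg_left h1 (by positivity)
    _ = (2 ^ S.card * √(∑ k ∈ S, A k ^ 2)) * (2 ^ S.card * √(∑ k ∈ S, B k ^ 2)) := by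
        rw [h2]; ring
    _ ≤ _ := mul_le_mul hA hB (by positivity) (le_trans (by positivity) hA)
    _ = _ := by ring

/-! ### Systems of planes -/

/-- A system of coordinates for a two-dimensional unconditional decomposition of `Y`: the image
of the `k`-th coordinate plane of `ℕ →₀ ℝ × ℝ` is the `k`-th summand, and multiplying the
coordinates by numbers in `[-1, 1]` does not increase the norm. -/
structure IsPlaneSystem {Y : Type*} [NormedAddCommGroup Y] [NormedSpace ℝ Y]
    (Ψ : (ℕ →₀ ℝ × ℝ) →ₗ[ℝ] Y) : Prop where
  injective : Function.Injective Ψ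
  denseRange : DenseRange Ψ
  norm_le : ∀ z z', (∀ k, ∃ θ : ℝ, |θ| ≤ 1 ∧ z k = θ • z' k) → ‖Ψ z‖ ≤ ‖Ψ z'‖

section PlaneSystem

variable {Y : Type*} [NormedAddCommGroup Y] [NormedSpace ℝ Y]

/-- The inclusion of the `k`-th plane. -/
def planeEmb (Ψ : (ℕ →₀ ℝ × ℝ) →ₗ[ℝ] Y) (k : ℕ) : ℝ × ℝ →L[ℝ] Y :=
  LinearMap.toContinuousLinearMap (Ψ ∘ₗ Finsupp.lsingle k)

/-- The coordinates in the `k`-th plane. -/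
def planeCoord (Ψ : (ℕ →₀ ℝ × ℝ) →ₗ[ℝ] Y) (k : ℕ) : Y →L[ℝ] ℝ × ℝ :=
  (Finsupp.lapply k : (ℕ →₀ ℝ × ℝ) →ₗ[ℝ] ℝ × ℝ).extendOfNorm Ψ

/-- The projection onto the `k`-th plane. -/
def planeProj (Ψ : (ℕ →₀ ℝ × ℝ) →ₗ[ℝ] Y) (k : ℕ) : Y →L[ℝ] Y := planeEmb Ψ k ∘L planeCoord Ψ k

variable {Ψ : (ℕ →₀ ℝ × ℝ) →ₗ[ℝ] Y}

lemma planeEmb_apply (k : ℕ) (v : ℝ × ℝ) : planeEmb Ψ k v = Ψ (Finsupp.single k v) := rfl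

lemma IsPlaneSystem.planeCoord_apply (h : IsPlaneSystem Ψ) (k : ℕ) (z : ℕ →₀ ℝ × ℝ) :
    planeCoord Ψ k (Ψ z) = z k := by
  refine LinearMap.extendOfNorm_eq h.denseRange ?_ z
  have hk : LinearMap.ker (Ψ ∘ₗ Finsupp.lsingle k : ℝ × ℝ →ₗ[ℝ] Y) = ⊥ :=
    LinearMap.ker_eq_bot.mpr (h.injective.comp (Finsupp.single_injective k))
  obtain ⟨K, -, hK⟩ := LinearMap.exists_antilipschitzWith _ hk
  refine ⟨K, fun z => ?_⟩
  refine (ZeroHomClass.bound_of_antilipschitz _ hK (z k)).trans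
    (mul_le_mul_of_nonneg_left (h.norm_le _ _ fun j => ?_) K.2)
  by_cases hj : j = k
  · exact ⟨1, by simp, by simp [hj]⟩
  · exact ⟨0, by simp, by simp [Ne.symm hj]⟩

lemma IsPlaneSystem.planeCoord_planeEmb (h : IsPlaneSystem Ψ) (k j : ℕ) (v : ℝ × ℝ) :
    planeCoord Ψ k (planeEmb Ψ j v) = if j = k then v else 0 := by
  rw [planeEmb_apply, h.planeCoord_apply, Finsupp.single_apply]

lemma IsPlaneSystem.planeCoord_sum (h : IsPlaneSystem Ψ) {S : Finset ℕ} {k : ℕ} (hk : k ∈ S)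
    (v : ℕ → ℝ × ℝ) : planeCoord Ψ k (∑ j ∈ S, planeEmb Ψ j (v j)) = v k := by
  rw [map_sum, Finset.sum_eq_single k]
  · rw [h.planeCoord_planeEmb, if_pos rfl]
  · intro j _ hj
    rw [h.planeCoord_planeEmb, if_neg hj]
  · exact fun hk' => absurd hk hk'

lemma IsPlaneSystem.norm_sum_smul_planeProj_le (h : IsPlaneSystem Ψ) (S : Finset ℕ) {θ : ℕ → ℝ}
    (hθ : ∀ k, |θ k| ≤ 1) (y : Y) : ‖∑ k ∈ S, θ k • planeProj Ψ k y‖ ≤ ‖y‖ := by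
  refine h.denseRange.induction_on (p := fun y => ‖∑ k ∈ S, θ k • planeProj Ψ k y‖ ≤ ‖y‖) y
    (isClosed_le (by fun_prop) (by fun_prop)) fun z => ?_
  have : ∑ k ∈ S, θ k • planeProj Ψ k (Ψ z) = Ψ (∑ k ∈ S, θ k • Finsupp.single k (z k)) := by
    rw [map_sum]
    refine Finset.sum_congr rfl fun k _ => ?_
    rw [map_smul, planeProj, ContinuousLinearMap.comp_apply, h.planeCoord_apply, planeEmb_apply]
  rw [this]
  refine h.norm_le _ _ fun j => ?_
  by_cases hj : j ∈ S
  · refine ⟨θ j, hθ j, ?_⟩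
    rw [Finsupp.finsetSum_apply, Finset.sum_eq_single j]
    · simp
    · intro k _ hk
      simp [hk]
    · exact fun h' => absurd hj h'
  · refine ⟨0, by simp, ?_⟩
    rw [Finsupp.finsetSum_apply, zero_smul]
    refine Finset.sum_eq_zero fun k hk => ?_
    have : k ≠ j := fun e => hj (e ▸ hk)
    simp [this]

lemma IsPlaneSystem.norm_sum_smul_planeEmb_le (h : IsPlaneSystem Ψ) (S : Finset ℕ) {θ : ℕ → ℝ}
    (hθ : ∀ k, |θ k| ≤ 1) (v : ℕ → ℝ × ℝ) :
    ‖∑ k ∈ S, θ k • planeEmb Ψ k (v k)‖ ≤ ‖∑ k ∈ S, planeEmb Ψ k (v k)‖ := by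
  refine le_trans (le_of_eq ?_) (h.norm_sum_smul_planeProj_le S hθ _)
  congr 1
  refine Finset.sum_congr rfl fun k hk => ?_
  rw [planeProj, ContinuousLinearMap.comp_apply, h.planeCoord_sum hk]

end PlaneSystem

/-! ### Diagonal operators from local unconditional structure -/

/-- Three linear forms on the plane, any two of which are linearly independent. -/
def planeForm : Fin 3 → ℝ × ℝ →ₗ[ℝ] ℝ :=
  ![LinearMap.fst ℝ ℝ ℝ, LinearMap.snd ℝ ℝ ℝ, LinearMap.fst ℝ ℝ ℝ - LinearMap.snd ℝ ℝ ℝ]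

/-- Vectors spanning the kernels of the three forms `planeForm`. -/
def planeKer : Fin 3 → ℝ × ℝ := ![(0, 1), (1, 0), (1, 1)]

/-- An operator of rank one on the plane whose trace is not small moves one of the three
lines spanned by the vectors `planeKer`. -/
lemma abs_trace_le (g : ℝ × ℝ →ₗ[ℝ] ℝ) (d : ℝ × ℝ) :
    |g (1, 0) * d.1 + g (0, 1) * d.2| ≤ 2 * ∑ i, |g (planeKer i) * planeForm i d| := by
  have h3 : g (1, 1) = g (1, 0) + g (0, 1) := by
    rw [← map_add]
    simp
  have hsum : ∑ i, |g (planeKer i) * planeForm i d| =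
      |g (0, 1) * d.1| + |g (1, 0) * d.2| + |(g (1, 0) + g (0, 1)) * (d.1 - d.2)| := by
    rw [Fin.sum_univ_three, ← h3]
    rfl
  rw [hsum]
  generalize g (1, 0) = a
  generalize g (0, 1) = b
  generalize d.1 = x
  generalize d.2 = y
  have hC : a * x - b * y = (a + b) * (x - y) + a * y - b * x := by ring
  have h1 := abs_nonneg (b * x)
  have h2 := abs_nonneg (a * y)
  have h4 := abs_nonneg ((a + b) * (x - y))
  refine abs_le_of_sq_le_sq ?_ (by linarith)
  have h5 : |a * x - b * y| ≤ |b * x| + |a * y| + |(a + b) * (x - y)| := by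
    rw [hC]
    have e1 := abs_add_le ((a + b) * (x - y)) (a * y)
    have e2 := abs_sub ((a + b) * (x - y) + a * y) (b * x)
    linarith
  have h6 : (a * x - b * y) ^ 2 ≤ (|b * x| + |a * y| + |(a + b) * (x - y)|) ^ 2 := by
    rw [← sq_abs (a * x - b * y)]
    exact pow_le_pow_left₀ (abs_nonneg _) h5 2
  have h7 : (b * x) * (a * y) ≤ |b * x| * |a * y| := by
    rw [← abs_mul]
    exact le_abs_self _
  nlinarith [mul_nonneg h1 h4, mul_nonneg h2 h4, mul_nonneg h1 h2, sq_nonneg |b * x|,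
    sq_nonneg |a * y|, sq_nonneg |(a + b) * (x - y)|]

section OneUnconditional

variable {F : Type*} [NormedAddCommGroup F] [NormedSpace ℝ F] {ι : Type*}

lemma norm_sum_sign_smul_le (b : UnconditionalSchauderBasis ι ℝ F)
    (hb : ∀ (s : Finset ι) (t ε : ι → ℝ), (∀ j, ε j = 1 ∨ ε j = -1) →
      ‖∑ j ∈ s, (ε j * t j) • b j‖ ≤ ‖∑ j ∈ s, t j • b j‖)
    (J : Finset ι) {ε : ι → ℝ} (hε : ∀ j, ε j = 1 ∨ ε j = -1) (g : F) :
    ‖∑ j ∈ J, (ε j * b.coord j g) • b j‖ ≤ ‖g‖ := by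
  classical
  have hlim : Tendsto (fun s : Finset ι => ‖∑ j ∈ s, b.coord j g • b j‖) atTop (𝓝 ‖g‖) := by
    have := (b.expansion g).norm
    simpa using this
  refine ge_of_tendsto hlim ?_
  filter_upwards [eventually_ge_atTop J] with s hs
  -- the sum over `J` is the mean of two sums over `s`, with opposite signs off `J`
  have hJ : ∑ j ∈ J, (ε j * b.coord j g) • b j = (1 / 2 : ℝ) •
      (∑ j ∈ s, ((if j ∈ J then ε j else 1) * b.coord j g) • b j +
        ∑ j ∈ s, ((if j ∈ J then ε j else -1) * b.coord j g) • b j) := by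
    rw [← Finset.sum_add_distrib, Finset.smul_sum]
    refine Finset.sum_subset_zero_on_sdiff hs (fun j hj => ?_) fun j hj => ?_
    · have := (Finset.mem_sdiff.mp hj).2
      simp [this]
    · rw [if_pos hj, if_pos hj, ← two_smul ℝ, smul_smul]
      norm_num
  rw [hJ, norm_smul]
  have h1 := hb s (fun j => b.coord j g) (fun j => if j ∈ J then ε j else 1) fun j => by
    split_ifs
    · exact hε j
    · exact Or.inl rfl
  have h2 := hb s (fun j => b.coord j g) (fun j => if j ∈ J then ε j else -1) fun j => by
    split_ifs
    · exact hε j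
    · exact Or.inr rfl
  have h3 := norm_add_le (∑ j ∈ s, ((if j ∈ J then ε j else 1) * b.coord j g) • b j)
    (∑ j ∈ s, ((if j ∈ J then ε j else -1) * b.coord j g) • b j)
  rw [Real.norm_of_nonneg (by norm_num)]
  linarith

lemma sum_abs_mul_abs_coord_le (b : UnconditionalSchauderBasis ι ℝ F)
    (hb : ∀ (s : Finset ι) (t ε : ι → ℝ), (∀ j, ε j = 1 ∨ ε j = -1) →
      ‖∑ j ∈ s, (ε j * t j) • b j‖ ≤ ‖∑ j ∈ s, t j • b j‖)
    (J : Finset ι) {c : ℝ} (ψ : F →ₗ[ℝ] ℝ) (hc : ∀ f, |ψ f| ≤ c * ‖f‖) (hc0 : 0 ≤ c) (g : F) :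
    ∑ j ∈ J, |ψ (b j)| * |b.coord j g| ≤ c * ‖g‖ := by
  let ε : ι → ℝ := fun j => if 0 ≤ ψ (b j) * b.coord j g then 1 else -1
  have hε : ∀ j, ε j = 1 ∨ ε j = -1 := fun j => by
    simp only [ε]
    split_ifs <;> simp
  have h1 : ∑ j ∈ J, |ψ (b j)| * |b.coord j g| = ψ (∑ j ∈ J, (ε j * b.coord j g) • b j) := by
    rw [map_sum]
    refine Finset.sum_congr rfl fun j _ => ?_
    rw [map_smul, smul_eq_mul, ← abs_mul]
    simp only [ε]
    split_ifs with h
    · rw [abs_of_nonneg h]; ring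
    · rw [abs_of_neg (not_le.mp h)]; ring
  rw [h1]
  exact (le_abs_self _).trans ((hc _).trans
    (mul_le_mul_of_nonneg_left (norm_sum_sign_smul_le b hb J hε g) hc0))

end OneUnconditional

section Diagonal

universe u

variable {Y : Type u} [NormedAddCommGroup Y] [NormedSpace ℝ Y]
  {Ψ : (ℕ →₀ ℝ × ℝ) →ₗ[ℝ] Y}

/-- Local unconditional structure of a space with a two-dimensional unconditional decomposition
yields uniformly bounded block diagonal operators, each block of which moves one of the three
lines spanned by the vectors `planeKer`.  If the identity factors as `w u` through a lattice `F`,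
the blocks are the compressions of `w M u`, with a multiplier `M` on `F` chosen separately for
each block; that these choices do no harm to the boundedness is due to Khinchine's inequality in
`F` and in its dual. -/
theorem HasLocalUnconditionalStructure.exists_diagonal (h : IsPlaneSystem Ψ)
    (hl : HasLocalUnconditionalStructure Y) :
    ∃ C : ℝ, 0 ≤ C ∧ ∀ S : Finset ℕ, ∃ (T : ℕ → ℝ × ℝ →ₗ[ℝ] ℝ × ℝ) (c : ℕ → Fin 3),
      (∀ k ∈ S, 1 / 6 ≤ planeForm (c k) (T k (planeKer (c k)))) ∧
      ∀ v : ℕ → ℝ × ℝ, ‖∑ k ∈ S, planeEmb Ψ k (T k (v k))‖ ≤ C * ‖∑ k ∈ S, planeEmb Ψ k (v k)‖ := by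
  classical
  obtain ⟨C, hC1, hF⟩ := hl
  refine ⟨4 * C, by linarith, fun S => ?_⟩
  let G : Finset Y := (S.image fun k => planeEmb Ψ k (1, 0)) ∪ S.image fun k => planeEmb Ψ k (0, 1)
  let X₀ : Submodule ℝ Y := Submodule.span ℝ (G : Set Y)
  have hmem : ∀ k ∈ S, ∀ v, planeEmb Ψ k v ∈ X₀ := by
    intro k hk v
    have hv : v = v.1 • ((1, 0) : ℝ × ℝ) + v.2 • ((0, 1) : ℝ × ℝ) := by
      ext <;> simp
    rw [hv, map_add, map_smul, map_smul]
    refine X₀.add_mem (X₀.smul_mem _ (Submodule.subset_span ?_))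
      (X₀.smul_mem _ (Submodule.subset_span ?_))
    · exact Finset.mem_coe.mpr (Finset.mem_union_left _ (Finset.mem_image_of_mem _ hk))
    · exact Finset.mem_coe.mpr (Finset.mem_union_right _ (Finset.mem_image_of_mem _ hk))
  obtain ⟨F, _, _, _, ⟨ι, _, b, hb⟩, u₀, w, hwu, hC⟩ := hF X₀ (FiniteDimensional.span_finset ℝ G)
  -- the restriction of `u₀` to the `k`-th plane
  let U : ℕ → ℝ × ℝ →ₗ[ℝ] F := fun k =>
    if hk : k ∈ S then u₀.toLinearMap ∘ₗ (planeEmb Ψ k).toLinearMap.codRestrict X₀ (hmem k hk)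
    else 0
  have hU : ∀ k ∈ S, ∀ v, ∀ hv, U k v = u₀ ⟨planeEmb Ψ k v, hv⟩ := by
    intro k hk v hv
    simp only [U, dif_pos hk]
    rfl
  have hwU : ∀ k ∈ S, ∀ v, w (U k v) = planeEmb Ψ k v := fun k hk v => by
    rw [hU k hk v (hmem k hk v), hwu]
  let g : ℕ → ι → ℝ × ℝ →ₗ[ℝ] ℝ := fun k j => (b.coord j).toLinearMap ∘ₗ U k
  let d : ℕ → ι → ℝ × ℝ := fun k j => planeCoord Ψ k (w (b j))
  -- the rank one operators `g k j ⊗ d k j` sum up to the identity of the `k`-th plane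
  have hsum : ∀ k ∈ S, ∀ (f : ℝ × ℝ →L[ℝ] ℝ) (v : ℝ × ℝ),
      HasSum (fun j => g k j v * f (d k j)) (f v) := by
    intro k hk f v
    have h1 := (f ∘L planeCoord Ψ k ∘L w).hasSum (b.expansion (U k v))
    simp only [ContinuousLinearMap.comp_apply, map_smul, smul_eq_mul] at h1
    rw [hwU k hk, h.planeCoord_planeEmb, if_pos rfl] at h1
    exact h1
  have htrace : ∀ k ∈ S, HasSum (fun j => g k j (1, 0) * (d k j).1 + g k j (0, 1) * (d k j).2)
      (1 + 1) := fun k hk =>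
    (hsum k hk (ContinuousLinearMap.fst ℝ ℝ ℝ) (1, 0)).add
      (hsum k hk (ContinuousLinearMap.snd ℝ ℝ ℝ) (0, 1))
  obtain ⟨J, hJ⟩ : ∃ J : Finset ι, ∀ k ∈ S,
      1 < ∑ j ∈ J, (g k j (1, 0) * (d k j).1 + g k j (0, 1) * (d k j).2) := by
    have h1 : ∀ᶠ J in (atTop : Filter (Finset ι)), ∀ k ∈ S,
        1 < ∑ j ∈ J, (g k j (1, 0) * (d k j).1 + g k j (0, 1) * (d k j).2) :=
      (Filter.eventually_all_finset S).mpr fun k hk => by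
        have h2 : Tendsto (fun J => ∑ j ∈ J,
            (g k j (1, 0) * (d k j).1 + g k j (0, 1) * (d k j).2)) atTop (𝓝 (1 + 1)) := by
          simpa [HasSum] using htrace k hk
        exact h2.eventually_const_lt (by norm_num)
    exact h1.exists
  have hc : ∀ k, ∃ i : Fin 3, k ∈ S →
      1 / 6 ≤ ∑ j ∈ J, |g k j (planeKer i) * planeForm i (d k j)| := by
    intro k
    by_contra! hne
    have hk : k ∈ S := (hne 0).1
    have h1 : ∑ j ∈ J, (g k j (1, 0) * (d k j).1 + g k j (0, 1) * (d k j).2) ≤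
        ∑ j ∈ J, 2 * ∑ i, |g k j (planeKer i) * planeForm i (d k j)| :=
      Finset.sum_le_sum fun j _ => (le_abs_self _).trans (abs_trace_le _ _)
    rw [← Finset.mul_sum, Finset.sum_comm, Fin.sum_univ_three] at h1
    have h2 := (hne 0).2
    have h3 := (hne 1).2
    have h4 := (hne 2).2
    have h5 := hJ k hk
    linarith
  choose c hc using hc
  let σ : ℕ → ι → ℝ := fun k j =>
    if 0 ≤ g k j (planeKer (c k)) * planeForm (c k) (d k j) then 1 else -1
  have hσ : ∀ k j, |σ k j| = 1 := fun k j => by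
    simp only [σ]
    split_ifs <;> simp
  refine ⟨fun k => ∑ j ∈ J, σ k j • (g k j).smulRight (d k j), c, fun k hk => ?_, fun v => ?_⟩
  · refine (hc k hk).trans_eq ?_
    simp only [LinearMap.sum_apply, LinearMap.smul_apply, LinearMap.smulRight_apply, map_sum,
      map_smul, smul_eq_mul]
    refine Finset.sum_congr rfl fun j _ => ?_
    simp only [σ]
    split_ifs with hs
    · rw [abs_of_nonneg hs, one_mul]
    · rw [abs_of_neg (not_le.mp hs), neg_one_mul]
  · obtain ⟨φ, hφ1, hφ⟩ := exists_dual_vector'' ℝ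
      (∑ k ∈ S, planeEmb Ψ k ((∑ j ∈ J, σ k j • (g k j).smulRight (d k j)) (v k)))
    have hφ' : ∀ y, |φ y| ≤ ‖y‖ := fun y => by
      simpa using φ.le_of_opNorm_le hφ1 y
    rw [RCLike.ofReal_real_eq_id, id] at hφ
    rw [← hφ]
    obtain ⟨y, hy⟩ : ∃ y, y = ∑ k ∈ S, planeEmb Ψ k (v k) := ⟨_, rfl⟩
    rw [← hy]
    let A : ι → ℕ → ℝ := fun j k => φ (planeEmb Ψ k (d k j))
    let B : ι → ℕ → ℝ := fun j k => g k j (v k)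
    have h1 : φ (∑ k ∈ S, planeEmb Ψ k ((∑ j ∈ J, σ k j • (g k j).smulRight (d k j)) (v k))) ≤
        ∑ j ∈ J, ∑ k ∈ S, |A j k| * |B j k| := by
      rw [Finset.sum_comm, map_sum]
      refine Finset.sum_le_sum fun k _ => ?_
      simp only [LinearMap.sum_apply, LinearMap.smul_apply, LinearMap.smulRight_apply, map_sum,
        map_smul, smul_eq_mul]
      refine Finset.sum_le_sum fun j _ => (le_abs_self _).trans_eq ?_
      rw [abs_mul, abs_mul, hσ, one_mul, mul_comm]
    have h2 : ∀ P ∈ S.powerset, ∀ Q ∈ S.powerset,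
        ∑ j ∈ J, |∑ k ∈ S, signOn P k * A j k| * |∑ k ∈ S, signOn Q k * B j k| ≤ C * ‖y‖ := by
      intro P _ Q _
      let ψ : F →ₗ[ℝ] ℝ :=
        φ.toLinearMap ∘ₗ (∑ k ∈ S, signOn P k • planeProj Ψ k).toLinearMap ∘ₗ w.toLinearMap
      have hψ : ∀ f, |ψ f| ≤ ‖w‖ * ‖f‖ := by
        intro f
        refine (hφ' _).trans (le_trans ?_ (w.le_opNorm f))
        have := h.norm_sum_smul_planeProj_le S (fun k => (abs_signOn P k).le) (w f)
        simpa [_root_.sum_apply] using this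
      have hyQ : ∑ k ∈ S, signOn Q k • planeEmb Ψ k (v k) ∈ X₀ :=
        X₀.sum_mem fun k hk => X₀.smul_mem _ (hmem k hk _)
      have hsumU : ∑ k ∈ S, signOn Q k • U k (v k) = u₀ ⟨_, hyQ⟩ := by
        have : (⟨_, hyQ⟩ : X₀) = ∑ k ∈ S.attach,
            signOn Q k • (⟨planeEmb Ψ k (v k), hmem k k.2 _⟩ : X₀) := by
          ext
          simp only [Submodule.coe_sum, Submodule.coe_smul]
          exact (Finset.sum_attach S fun k => signOn Q k • planeEmb Ψ k (v k)).symm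
        rw [this, map_sum, ← Finset.sum_attach]
        refine Finset.sum_congr rfl fun k _ => ?_
        rw [map_smul, hU k k.2 _ (hmem k k.2 _)]
      have h3 := sum_abs_mul_abs_coord_le b hb J ψ hψ (norm_nonneg w)
        (∑ k ∈ S, signOn Q k • U k (v k))
      refine le_trans (le_of_eq ?_) (h3.trans ?_)
      · refine Finset.sum_congr rfl fun j _ => ?_
        congr 2
        · simp [ψ, A, d, planeProj]
        · simp [B, g]
      · rw [hsumU]
        have h4 : ‖(⟨_, hyQ⟩ : X₀)‖ ≤ ‖y‖ := by
          rw [hy]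
          exact h.norm_sum_smul_planeEmb_le S (fun k => (abs_signOn Q k).le) v
        calc ‖w‖ * ‖u₀ ⟨_, hyQ⟩‖ ≤ ‖w‖ * (‖u₀‖ * ‖y‖) :=
              mul_le_mul_of_nonneg_left ((u₀.le_opNorm _).trans
                (mul_le_mul_of_nonneg_left h4 (norm_nonneg _))) (norm_nonneg _)
          _ = (‖u₀‖ * ‖w‖) * ‖y‖ := by ring
          _ ≤ C * ‖y‖ := mul_le_mul_of_nonneg_right hC (norm_nonneg _)
    have h5 : 4 ^ S.card * ∑ j ∈ J, ∑ k ∈ S, |A j k| * |B j k| ≤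
        4 * ∑ P ∈ S.powerset, ∑ Q ∈ S.powerset, ∑ j ∈ J,
          |∑ k ∈ S, signOn P k * A j k| * |∑ k ∈ S, signOn Q k * B j k| := by
      rw [Finset.mul_sum]
      refine (Finset.sum_le_sum fun j _ => sum_abs_mul_abs_le S (A j) (B j)).trans_eq ?_
      rw [← Finset.mul_sum, Finset.sum_comm]
      congr 1
      refine Finset.sum_congr rfl fun P _ => Finset.sum_comm
    have h6 : ∑ P ∈ S.powerset, ∑ Q ∈ S.powerset, ∑ j ∈ J,
          |∑ k ∈ S, signOn P k * A j k| * |∑ k ∈ S, signOn Q k * B j k| ≤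
        4 ^ S.card * (C * ‖y‖) := by
      refine (Finset.sum_le_sum fun P hP => Finset.sum_le_sum fun Q hQ => h2 P hP Q hQ).trans_eq ?_
      rw [Finset.sum_const, Finset.sum_const, Finset.card_powerset, nsmul_eq_mul, nsmul_eq_mul,
        ← mul_assoc]
      congr 1
      push_cast
      rw [← mul_pow]
      norm_num
    have h7 : (0 : ℝ) < 4 ^ S.card := by positivity
    refine h1.trans (le_of_mul_le_mul_left ?_ h7)
    linarith

end Diagonal

/-! ### The unconditional decomposition -/

section PlaneSystem

variable {Y : Type*} [NormedAddCommGroup Y] [NormedSpace ℝ Y] {Ψ : (ℕ →₀ ℝ × ℝ) →ₗ[ℝ] Y}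

lemma IsPlaneSystem.tendsto_sum_planeProj (h : IsPlaneSystem Ψ) (y : Y) :
    Tendsto (fun n => ∑ k ∈ Finset.range n, planeProj Ψ k y) atTop (𝓝 y) := by
  have hone : ∀ (n : ℕ) (x : Y), ‖∑ k ∈ Finset.range n, planeProj Ψ k x‖ ≤ ‖x‖ := fun n x => by
    simpa using h.norm_sum_smul_planeProj_le (Finset.range n) (θ := fun _ => 1) (by simp) x
  rw [Metric.tendsto_atTop]
  intro ε hε
  obtain ⟨z, hz⟩ := h.denseRange.exists_dist_lt y (half_pos hε)
  refine ⟨z.support.sup id + 1, fun n hn => ?_⟩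
  have hfix : ∑ k ∈ Finset.range n, planeProj Ψ k (Ψ z) = Ψ z := by
    have hsub : z.support ⊆ Finset.range n := fun i hi => by
      have : i ≤ z.support.sup id := Finset.le_sup (f := id) hi
      rw [Finset.mem_range]
      omega
    conv_rhs => rw [← Finsupp.sum_single z, Finsupp.sum_of_support_subset _ hsub _ (by simp),
      map_sum]
    refine Finset.sum_congr rfl fun k _ => ?_
    rw [planeProj, ContinuousLinearMap.comp_apply, h.planeCoord_apply, planeEmb_apply]
  have hsplit : ∑ k ∈ Finset.range n, planeProj Ψ k y - y =
      ∑ k ∈ Finset.range n, planeProj Ψ k (y - Ψ z) - (y - Ψ z) := by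
    simp only [map_sub, Finset.sum_sub_distrib, hfix]
    abel
  rw [dist_eq_norm, hsplit]
  rw [dist_eq_norm] at hz
  have h1 := norm_sub_le (∑ k ∈ Finset.range n, planeProj Ψ k (y - Ψ z)) (y - Ψ z)
  have h2 := hone n (y - Ψ z)
  linarith

theorem IsPlaneSystem.hasUnconditionalDecomposition (h : IsPlaneSystem Ψ) :
    HasUnconditionalDecomposition 2 Y := by
  have hinj : ∀ k, Function.Injective (planeEmb Ψ k).toLinearMap := fun k =>
    h.injective.comp (Finsupp.single_injective k)
  refine ⟨fun k => LinearMap.range (planeEmb Ψ k).toLinearMap, ⟨fun k => ?_, fun x => ?_⟩,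
    fun k => ⟨inferInstance, ?_⟩, 1, fun S z ε hz hε => ?_⟩
  · exact Submodule.closed_of_finiteDimensional _
  · refine ⟨fun k => planeProj Ψ k x, ⟨fun k => ⟨_, rfl⟩, h.tendsto_sum_planeProj x⟩, ?_⟩
    rintro z ⟨hz, hlim⟩
    choose v hv using hz
    ext k
    have h1 : Tendsto (fun n => planeProj Ψ k (∑ j ∈ Finset.range n, z j)) atTop
        (𝓝 (planeProj Ψ k x)) := ((planeProj Ψ k).continuous.tendsto x).comp hlim
    refine tendsto_nhds_unique (tendsto_const_nhds.congr' ?_) h1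
    filter_upwards [eventually_gt_atTop k] with n hn
    have h2 : ∑ j ∈ Finset.range n, z j = ∑ j ∈ Finset.range n, planeEmb Ψ j (v j) :=
      Finset.sum_congr rfl fun j _ => (hv j).symm
    rw [h2, planeProj, ContinuousLinearMap.comp_apply, h.planeCoord_sum (Finset.mem_range.mpr hn)]
    exact (hv k).symm
  · rw [LinearMap.finrank_range_of_inj (hinj k)]
    simp
  · choose v hv using hz
    have h1 : z = fun k => planeEmb Ψ k (v k) := funext fun k => (hv k).symm
    rw [one_mul, h1]
    refine h.norm_sum_smul_planeEmb_le S (fun k => ?_) v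
    rcases hε k with hk | hk <;> simp [hk]

end PlaneSystem

/-! ### The Gordon–Lewis property -/

/-- An operator from the plane factors, with a uniform constant, through the plane with the `ℓ₁`
norm. -/
lemma exists_plane_factorization {W : Type*} [NormedAddCommGroup W] [NormedSpace ℝ W]
    (f : ℝ × ℝ →ₗ[ℝ] W) :
    ∃ (g : Fin 2 → ℝ × ℝ →ₗ[ℝ] ℝ) (w : Fin 2 → W), (∀ i, ‖w i‖ ≤ 1) ∧
      (∀ x, f x = ∑ i, g i x • w i) ∧ ∀ i x, |g i x| ≤ 2 * ‖f x‖ := by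
  obtain ⟨φ, w, hφ, hw, hx⟩ : ∃ (φ : StrongDual ℝ W) (w : W), ‖φ‖ ≤ 1 ∧ ‖w‖ ≤ 1 ∧
      f (1, 0) = φ (f (1, 0)) • w := by
    obtain ⟨φ, hφ, hφx⟩ := exists_dual_vector'' ℝ (f (1, 0))
    rw [RCLike.ofReal_real_eq_id, id] at hφx
    refine ⟨φ, ‖f (1, 0)‖⁻¹ • f (1, 0), hφ, ?_, ?_⟩
    · rw [norm_smul, norm_inv, norm_norm]
      exact inv_mul_le_one
    · rw [hφx, smul_smul]
      rcases eq_or_ne (f (1, 0)) 0 with h0 | h0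
      · simp [h0]
      · rw [mul_inv_cancel₀ (norm_ne_zero_iff.mpr h0), one_smul]
  have hφ' : ∀ y, |φ y| ≤ ‖y‖ := fun y => by simpa using φ.le_of_opNorm_le hφ y
  obtain ⟨r, hr⟩ : ∃ r, r = f (0, 1) - φ (f (0, 1)) • w := ⟨_, rfl⟩
  have hres : ∀ x : ℝ × ℝ, f x - φ (f x) • w = x.2 • r := by
    intro x
    have hv : x = x.1 • ((1, 0) : ℝ × ℝ) + x.2 • ((0, 1) : ℝ × ℝ) := by
      ext <;> simp
    have h1 : f x = x.1 • f (1, 0) + x.2 • f (0, 1) := by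
      conv_lhs => rw [hv, map_add, map_smul, map_smul]
    have h2 : x.1 • f (1, 0) = (x.1 * φ (f (1, 0))) • w := by
      conv_lhs => rw [hx, smul_smul]
    rw [h1, map_add, map_smul, map_smul, hr, smul_sub, smul_smul, smul_eq_mul, smul_eq_mul,
      add_smul, h2]
    abel
  refine ⟨![φ.toLinearMap ∘ₗ f, ‖r‖ • LinearMap.snd ℝ ℝ ℝ], ![w, ‖r‖⁻¹ • r], fun i => ?_,
    fun x => ?_, fun i x => ?_⟩
  · fin_cases i
    · exact hw
    · simp only [Fin.mk_one, Matrix.cons_val_one, Matrix.cons_val_zero, norm_smul, norm_inv,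
        norm_norm]
      exact inv_mul_le_one
  · have h1 : (‖r‖ * x.2) • ‖r‖⁻¹ • r = x.2 • r := by
      rcases eq_or_ne r 0 with h0 | h0
      · simp [h0]
      · rw [smul_smul, mul_right_comm, mul_inv_cancel₀ (norm_ne_zero_iff.mpr h0), one_mul]
    have h2 : f x = φ (f x) • w + x.2 • r := by
      rw [← hres x]
      abel
    simpa [Fin.sum_univ_two, h1] using h2
  · have h0 := norm_nonneg (f x)
    fin_cases i
    · exact (hφ' (f x)).trans (by linarith)
    · change |‖r‖ * x.2| ≤ 2 * ‖f x‖
      have h1 : |‖r‖ * x.2| = ‖x.2 • r‖ := by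
        rw [norm_smul, abs_mul, abs_norm, mul_comm, Real.norm_eq_abs]
      rw [h1, ← hres x]
      refine (norm_sub_le _ _).trans ?_
      have h2 : ‖φ (f x) • w‖ ≤ ‖f x‖ := by
        rw [norm_smul, Real.norm_eq_abs]
        exact (mul_le_mul (hφ' _) hw (norm_nonneg _) h0).trans_eq (mul_one _)
      linarith

open MeasureTheory in
/-- An operator which is given by a bounded sequence of vectors and a sequence of functionals
with pointwise summable values factors through the space `L₁` of a counting measure. -/
lemma exists_l1_factorization {Y W : Type*} [NormedAddCommGroup Y] [NormedSpace ℝ Y]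
    [NormedAddCommGroup W] [NormedSpace ℝ W] [CompleteSpace W]
    {Ω : Type*} [Countable Ω] [MeasurableSpace Ω] [DiscreteMeasurableSpace Ω]
    (A : Y →ₗ[ℝ] Ω → ℝ) (w : Ω → W) (hw : ∀ ω, ‖w ω‖ ≤ 1) {K : ℝ} (hK : 0 ≤ K)
    (hA : ∀ y (s : Finset Ω), ∑ ω ∈ s, |A y ω| ≤ K * ‖y‖) (v : Y →L[ℝ] W)
    (hv : ∀ y, ∑' ω, A y ω • w ω = v y) :
    ∃ (a : Y →L[ℝ] Lp ℝ 1 (Measure.count : Measure Ω))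
      (b : Lp ℝ 1 (Measure.count : Measure Ω) →L[ℝ] W), v = b ∘L a ∧ ‖a‖ * ‖b‖ ≤ K := by
  have hsum : ∀ y, Summable fun ω => ‖A y ω‖ := fun y =>
    summable_of_sum_le (fun _ => norm_nonneg _) (hA y)
  have hint : ∀ y, Integrable (A y) (Measure.count : Measure Ω) := fun y =>
    integrable_count_iff.mpr (hsum y)
  have hcount : ∀ ω : Ω, (Measure.count : Measure Ω).real {ω} = 1 := fun ω => by
    simp [Measure.real]
  have hwm : AEStronglyMeasurable w (Measure.count : Measure Ω) :=
    (StronglyMeasurable.of_discrete).aestronglyMeasurable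
  have hmul : ∀ F : Ω → ℝ, Integrable F (Measure.count : Measure Ω) →
      Integrable (fun ω => F ω • w ω) (Measure.count : Measure Ω) := fun F hF =>
    hF.smul_bdd 1 hwm (Eventually.of_forall hw)
  let aL : Y →ₗ[ℝ] Lp ℝ 1 (Measure.count : Measure Ω) :=
    { toFun := fun y => (hint y).toL1 (A y)
      map_add' := fun x y => by
        rw [← Integrable.toL1_add]
        congr 1
        exact map_add A x y
      map_smul' := fun c y => by
        rw [RingHom.id_apply, ← Integrable.toL1_smul]
        congr 1
        exact map_smul A c y }
  have ha : ∀ y, ‖aL y‖ ≤ K * ‖y‖ := by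
    intro y
    change ‖(hint y).toL1 (A y)‖ ≤ _
    rw [L1.norm_of_fun_eq_integral_norm, integral_countable (hint y).norm]
    simp only [hcount, one_smul]
    exact (hsum y).tsum_le_of_sum_le (hA y)
  let bL : Lp ℝ 1 (Measure.count : Measure Ω) →ₗ[ℝ] W :=
    { toFun := fun F => ∫ ω, F ω • w ω ∂Measure.count
      map_add' := fun F G => by
        rw [← integral_add (hmul _ (L1.integrable_coeFn F)) (hmul _ (L1.integrable_coeFn G))]
        refine integral_congr_ae ?_
        filter_upwards [Lp.coeFn_add F G] with ω hω
        rw [hω, Pi.add_apply, add_smul]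
      map_smul' := fun c F => by
        rw [RingHom.id_apply, ← integral_smul]
        refine integral_congr_ae ?_
        filter_upwards [Lp.coeFn_smul c F] with ω hω
        rw [hω, Pi.smul_apply, smul_eq_mul, mul_smul] }
  have hb : ∀ F, ‖bL F‖ ≤ 1 * ‖F‖ := by
    intro F
    rw [one_mul, L1.norm_eq_integral_norm]
    refine norm_integral_le_of_norm_le (L1.integrable_coeFn F).norm (Eventually.of_forall ?_)
    intro ω
    rw [norm_smul]
    exact (mul_le_mul_of_nonneg_left (hw ω) (norm_nonneg _)).trans_eq (mul_one _)
  refine ⟨aL.mkContinuous K ha, bL.mkContinuous 1 hb, ?_, ?_⟩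
  · ext y
    rw [ContinuousLinearMap.comp_apply, LinearMap.mkContinuous_apply,
      LinearMap.mkContinuous_apply, ← hv y]
    have h1 : bL (aL y) = ∫ ω, A y ω • w ω ∂Measure.count := by
      refine integral_congr_ae ?_
      filter_upwards [Integrable.coeFn_toL1 (hint y)] with ω hω
      change ((hint y).toL1 (A y)) ω • w ω = _
      rw [hω]
    rw [h1, integral_countable (hmul _ (hint y))]
    simp only [hcount, one_smul]
  · calc _ ≤ K * 1 := mul_le_mul (aL.mkContinuous_norm_le hK ha)
          (bL.mkContinuous_norm_le zero_le_one hb) (norm_nonneg _) hK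
      _ = K := mul_one K

universe u

/-- A two-dimensional unconditional decomposition implies the Gordon–Lewis property: for a
`1`-summing operator `v` the norms of the images under `v` of the components of a vector are
summable, and on each component `v` factors through a two-dimensional `ℓ₁`. -/
theorem IsPlaneSystem.hasGordonLewisProperty {Y : Type u} [NormedAddCommGroup Y]
    [NormedSpace ℝ Y] {Ψ : (ℕ →₀ ℝ × ℝ) →ₗ[ℝ] Y} (h : IsPlaneSystem Ψ) :
    HasGordonLewisProperty Y := by
  classical
  refine ⟨4, fun W _ _ _ v c hv => ?_⟩
  obtain ⟨hc, hv⟩ := hv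
  have hsum : ∀ (n : ℕ) (y : Y), ∑ k ∈ Finset.range n, ‖v (planeProj Ψ k y)‖ ≤ c * ‖y‖ := by
    intro n y
    have h1 := hv n fun k => planeProj Ψ k y
    rw [← Finset.sum_range (f := fun k => ‖v (planeProj Ψ k y)‖)] at h1
    refine h1.trans (mul_le_mul_of_nonneg_left ?_ hc)
    have : Nonempty {f : StrongDual ℝ Y // ‖f‖ ≤ 1} := ⟨⟨0, by simp⟩⟩
    refine ciSup_le fun f => ?_
    rw [← Finset.sum_range (f := fun k => |f.1 (planeProj Ψ k y)|)]
    let θ : ℕ → ℝ := fun k => if 0 ≤ f.1 (planeProj Ψ k y) then 1 else -1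
    have hθ : ∀ k, |θ k| ≤ 1 := fun k => by
      simp only [θ]
      split_ifs <;> simp
    have h2 : ∑ k ∈ Finset.range n, |f.1 (planeProj Ψ k y)| =
        f.1 (∑ k ∈ Finset.range n, θ k • planeProj Ψ k y) := by
      rw [map_sum]
      refine Finset.sum_congr rfl fun k _ => ?_
      rw [map_smul, smul_eq_mul]
      simp only [θ]
      split_ifs with hk
      · rw [abs_of_nonneg hk, one_mul]
      · rw [abs_of_neg (not_le.mp hk), neg_one_mul]
    rw [h2]
    refine (le_abs_self _).trans ((f.1.le_of_opNorm_le f.2 _).trans ?_)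
    rw [one_mul]
    exact h.norm_sum_smul_planeProj_le _ hθ y
  choose g w hw hgw hg using fun k =>
    exists_plane_factorization (v.toLinearMap ∘ₗ (planeEmb Ψ k).toLinearMap)
  let A : Y →ₗ[ℝ] ULift.{u} (ℕ × Fin 2) → ℝ :=
    LinearMap.pi fun ω => g ω.down.1 ω.down.2 ∘ₗ (planeCoord Ψ ω.down.1).toLinearMap
  let : MeasurableSpace (ULift.{u} (ℕ × Fin 2)) := ⊤
  have : DiscreteMeasurableSpace (ULift.{u} (ℕ × Fin 2)) := ⟨fun _ => trivial⟩
  have hA : ∀ y (s : Finset (ULift.{u} (ℕ × Fin 2))), ∑ ω ∈ s, |A y ω| ≤ 4 * c * ‖y‖ := by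
    intro y s
    let n := s.sup (fun ω => ω.down.1) + 1
    have hsub : s ⊆ (Finset.range n ×ˢ (Finset.univ : Finset (Fin 2))).map
        Equiv.ulift.symm.toEmbedding := by
      intro ω hω
      have h1 : ω.down.1 ≤ s.sup (fun ω => ω.down.1) :=
        Finset.le_sup (f := fun ω : ULift.{u} (ℕ × Fin 2) => ω.down.1) hω
      simp only [Finset.mem_map, Finset.mem_product, Finset.mem_range, Finset.mem_univ, and_true]
      exact ⟨ω.down, Nat.lt_succ_of_le h1, rfl⟩
    refine (Finset.sum_le_sum_of_subset_of_nonneg hsub fun _ _ _ => abs_nonneg _).trans ?_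
    rw [Finset.sum_map, Finset.sum_product]
    have h2 : ∀ k, ∑ i, |A y ⟨(k, i)⟩| ≤ 4 * ‖v (planeProj Ψ k y)‖ := by
      intro k
      have h3 : ∀ i, |A y ⟨(k, i)⟩| ≤ 2 * ‖v (planeProj Ψ k y)‖ := fun i =>
        hg k i (planeCoord Ψ k y)
      rw [Fin.sum_univ_two]
      linarith [h3 0, h3 1]
    refine (Finset.sum_le_sum fun k _ => h2 k).trans ?_
    rw [← Finset.mul_sum, mul_assoc]
    exact mul_le_mul_of_nonneg_left (hsum n y) (by norm_num)
  obtain ⟨a, b, hab, hle⟩ := exists_l1_factorization A (fun ω => w ω.down.1 ω.down.2)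
    (fun ω => hw _ _) (by positivity : 0 ≤ 4 * c) hA v fun y => by
      have hs : Summable fun ω => A y ω • w ω.down.1 ω.down.2 := by
        refine Summable.of_norm_bounded (summable_of_sum_le (fun _ => abs_nonneg _) (hA y)) ?_
        intro ω
        rw [norm_smul, Real.norm_eq_abs]
        exact (mul_le_mul_of_nonneg_left (hw _ _) (abs_nonneg _)).trans_eq (mul_one _)
      have hs' : HasSum (fun x : ℕ × Fin 2 => A y ⟨x⟩ • w x.1 x.2)
          (∑' ω, A y ω • w ω.down.1 ω.down.2) :=
        (Equiv.ulift.symm.hasSum_iff (f := fun ω => A y ω • w ω.down.1 ω.down.2)).mpr hs.hasSum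
      have h1 : HasSum (fun k => v (planeProj Ψ k y)) (∑' ω, A y ω • w ω.down.1 ω.down.2) := by
        have h2 := hs'.prod_fiberwise fun k => hasSum_fintype _
        convert h2 using 2 with k
        exact hgw k (planeCoord Ψ k y)
      refine tendsto_nhds_unique h1.tendsto_sum_nat ?_
      have h3 := (v.continuous.tendsto y).comp (h.tendsto_sum_planeProj y)
      simpa [Function.comp_def] using h3
  exact ⟨_, _, _, a, b, hab, hle⟩

/-! ### A criterion for subspaces without local unconditional structure -/

/-- The sequence norm `N` has, on coordinates beyond `M`, three weighted families of basis
vectors which compete in the following sense: however the indices are distributed among the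
three families, there are coefficients, supported by the indices given to one of them, for which
this family dominates the other two by the factor `D`. -/
def HasCompetingFamilies (N : (ℕ →₀ ℝ) → ℝ) (D : ℝ) (M : ℕ) : Prop :=
  ∃ (ι : Type) (_ : Fintype ι) (pos : Fin 3 → ι → ℕ) (wt : Fin 3 → ι → ℝ),
    (Function.Injective fun x : Fin 3 × ι => pos x.1 x.2) ∧ (∀ i k, M ≤ pos i k) ∧
    (∀ i k, 0 < wt i k) ∧
    ∀ c : ι → Fin 3, ∃ (i : Fin 3) (t : ι → ℝ), (∀ k, c k ≠ i → t k = 0) ∧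
      D * ∑ i' ∈ Finset.univ.erase i, N (spread (pos i') fun k => wt i' k * t k) <
        N (spread (pos i) fun k => wt i k * t k)

lemma planeForm_planeKer_self (i : Fin 3) : planeForm i (planeKer i) = 0 := by
  fin_cases i <;> simp [planeForm, planeKer]

lemma abs_planeForm_planeKer {i i' : Fin 3} (h : i' ≠ i) : |planeForm i' (planeKer i)| = 1 := by
  fin_cases i <;> fin_cases i' <;> simp [planeForm, planeKer] at h ⊢

lemma eq_zero_of_planeForm {v : ℝ × ℝ} (h : ∀ i, planeForm i v = 0) : v = 0 :=
  Prod.ext (h 0) (h 1)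

/-- Three weighted families of basis vectors as a single map from sequences of vectors of the
plane: the coordinates of the `k`-th vector in the three families are its values under the three
forms. -/
def planeSeq (pos : Fin 3 → ℕ → ℕ) (wt : Fin 3 → ℕ → ℝ) : (ℕ →₀ ℝ × ℝ) →ₗ[ℝ] ℕ →₀ ℝ :=
  Finsupp.lsum ℝ fun k => ∑ i, wt i k • (Finsupp.lsingle (pos i k) ∘ₗ planeForm i)

section PlaneSeq

variable {pos : Fin 3 → ℕ → ℕ} {wt : Fin 3 → ℕ → ℝ}

lemma planeSeq_single (k : ℕ) (v : ℝ × ℝ) :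
    planeSeq pos wt (Finsupp.single k v) =
      ∑ i, Finsupp.single (pos i k) (wt i k * planeForm i v) := by
  simp [planeSeq]

lemma planeSeq_apply (hinj : Function.Injective fun x : Fin 3 × ℕ => pos x.1 x.2)
    (z : ℕ →₀ ℝ × ℝ) (i : Fin 3) (k : ℕ) :
    planeSeq pos wt z (pos i k) = wt i k * planeForm i (z k) := by
  classical
  induction z using Finsupp.induction_linear with
  | zero => simp
  | add x y hx hy => rw [map_add, Finsupp.add_apply, hx, hy, Finsupp.add_apply, map_add, mul_add]
  | single j v =>
    rw [planeSeq_single, Finsupp.finsetSum_apply]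
    have hne : ∀ i', (i', j) ≠ (i, k) → pos i k ≠ pos i' j := fun i' h1 h2 =>
      h1 (hinj (a₁ := (i', j)) (a₂ := (i, k)) h2.symm)
    by_cases hj : j = k
    · subst hj
      rw [Finset.sum_eq_single i]
      · simp
      · intro i' _ hi
        exact Finsupp.single_eq_of_ne (hne i' fun h => hi (Prod.ext_iff.mp h).1)
      · simp
    · rw [Finsupp.single_apply, if_neg hj, map_zero, mul_zero]
      exact Finset.sum_eq_zero fun i' _ =>
        Finsupp.single_eq_of_ne (hne i' fun h => hj (Prod.ext_iff.mp h).2)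

lemma planeSeq_apply_of_notMem (z : ℕ →₀ ℝ × ℝ) {n : ℕ} (h : ∀ i k, pos i k ≠ n) :
    planeSeq pos wt z n = 0 := by
  induction z using Finsupp.induction_linear with
  | zero => simp
  | add x y hx hy => rw [map_add, Finsupp.add_apply, hx, hy, add_zero]
  | single j v =>
    rw [planeSeq_single, Finsupp.finsetSum_apply]
    exact Finset.sum_eq_zero fun i _ => Finsupp.single_eq_of_ne (h i j).symm

end PlaneSeq

section Criterion

variable {X : Type u} [NormedAddCommGroup X] [NormedSpace ℝ X] {J : (ℕ →₀ ℝ) →ₗ[ℝ] X}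

lemma injective_of_norm_mono (hmono : ∀ x y : ℕ →₀ ℝ, (∀ n, |x n| ≤ |y n|) → ‖J x‖ ≤ ‖J y‖)
    (hne : ∀ n, J (Finsupp.single n 1) ≠ 0) : Function.Injective J := by
  rw [injective_iff_map_eq_zero]
  intro x hx
  ext n
  have h1 : ‖J (Finsupp.single n (x n))‖ ≤ ‖J x‖ := hmono _ _ fun j => by
    rw [Finsupp.single_apply]
    split_ifs with h
    · rw [h]
    · simp
  rw [hx, norm_zero, ← mul_one (x n), ← smul_eq_mul, ← Finsupp.smul_single, map_smul, norm_smul]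
    at h1
  have h2 : 0 < ‖J (Finsupp.single n 1)‖ := norm_pos_iff.mpr (hne n)
  have h3 : ‖x n‖ ≤ 0 := by
    by_contra! h
    exact absurd h1 (not_le.mpr (mul_pos h h2))
  simpa using h3

lemma isPlaneSystem_planeSeq {pos : Fin 3 → ℕ → ℕ} {wt : Fin 3 → ℕ → ℝ}
    (hmono : ∀ x y : ℕ →₀ ℝ, (∀ n, |x n| ≤ |y n|) → ‖J x‖ ≤ ‖J y‖)
    (hne : ∀ n, J (Finsupp.single n 1) ≠ 0)
    (hinj : Function.Injective fun x : Fin 3 × ℕ => pos x.1 x.2) (hwt : ∀ i k, 0 < wt i k)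
    {Y : Submodule ℝ X} (hY : Y = (LinearMap.range (J ∘ₗ planeSeq pos wt)).topologicalClosure)
    (hmem : ∀ z, (J ∘ₗ planeSeq pos wt) z ∈ Y) :
    IsPlaneSystem ((J ∘ₗ planeSeq pos wt).codRestrict Y hmem) := by
  refine ⟨?_, ?_, fun z z' h => ?_⟩
  · rw [injective_iff_map_eq_zero]
    intro z hz
    replace hz : planeSeq pos wt z = 0 := by
      refine injective_of_norm_mono hmono hne ?_
      rw [map_zero]
      exact congrArg Subtype.val hz
    ext1 k
    refine eq_zero_of_planeForm fun i => ?_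
    have h1 := planeSeq_apply (wt := wt) hinj z i k
    rw [hz, Finsupp.coe_zero, Pi.zero_apply] at h1
    exact (mul_eq_zero.mp h1.symm).resolve_left (hwt i k).ne'
  · refine Metric.denseRange_iff.mpr fun y r hr => ?_
    have hy : (y : X) ∈ closure (LinearMap.range (J ∘ₗ planeSeq pos wt) : Set X) := by
      rw [← Submodule.topologicalClosure_coe, ← hY]
      exact y.2
    obtain ⟨_, ⟨z, rfl⟩, hz⟩ := Metric.mem_closure_iff.mp hy r hr
    exact ⟨z, hz⟩
  · refine hmono _ _ fun n => ?_
    by_cases hn : ∃ i k, pos i k = n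
    · obtain ⟨i, k, rfl⟩ := hn
      rw [planeSeq_apply hinj, planeSeq_apply hinj]
      obtain ⟨θ, hθ, hz⟩ := h k
      rw [hz, map_smul, smul_eq_mul, abs_mul, abs_mul, abs_mul]
      refine mul_le_mul_of_nonneg_left ?_ (abs_nonneg _)
      exact (mul_le_mul_of_nonneg_right hθ (abs_nonneg _)).trans_eq (one_mul _)
    · push Not at hn
      rw [planeSeq_apply_of_notMem z hn, planeSeq_apply_of_notMem z' hn]

/-- A sequence of competing families on successive sets of coordinates. -/
lemma exists_seq_competingFamilies {N : (ℕ →₀ ℝ) → ℝ} (hN : N 0 = 0)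
    (h : ∀ (D : ℝ) (M : ℕ), HasCompetingFamilies N D M) :
    ∃ (pos : Fin 3 → ℕ → ℕ) (wt : Fin 3 → ℕ → ℝ),
      (Function.Injective fun x : Fin 3 × ℕ => pos x.1 x.2) ∧ (∀ i k, 0 < wt i k) ∧
      ∀ m : ℕ, ∃ (ι : Type) (_ : Fintype ι) (g : ι → ℕ), Function.Injective g ∧
        ∀ c : ℕ → Fin 3, ∃ (i : Fin 3) (t : ι → ℝ), (∀ k, c (g k) ≠ i → t k = 0) ∧
          m * ∑ i' ∈ Finset.univ.erase i,
              N (spread (fun k => pos i' (g k)) fun k => wt i' (g k) * t k) <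
            N (spread (fun k => pos i (g k)) fun k => wt i (g k) * t k) := by
  classical
  choose ι inst pos wt hinj hM hwt htest using fun (m M : ℕ) => h m M
  obtain ⟨s, hs⟩ : ∃ s : ℕ → ℕ, ∀ m, s (m + 1) = max (s m)
      ((Finset.univ.sup fun x : Fin 3 × ι m (s m) => pos m (s m) x.1 x.2) + 1) :=
    ⟨fun i => Nat.rec 0 (fun m a => max a
      ((Finset.univ.sup fun x : Fin 3 × ι m a => pos m a x.1 x.2) + 1)) i, fun _ => rfl⟩
  have hsm : Monotone s := monotone_nat_of_le_succ fun m => by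
    rw [hs]
    exact le_max_left _ _
  have hlt : ∀ m i k, pos m (s m) i k < s (m + 1) := fun m i k => by
    have : pos m (s m) i k ≤ Finset.univ.sup fun x : Fin 3 × ι m (s m) => pos m (s m) x.1 x.2 :=
      Finset.le_sup (f := fun x : Fin 3 × ι m (s m) => pos m (s m) x.1 x.2)
        (Finset.mem_univ (i, k))
    rw [hs]
    omega
  have hnon : ∀ m, Nonempty (ι m (s m)) := fun m => by
    by_contra hemp
    rw [not_nonempty_iff] at hemp
    obtain ⟨i, t, -, ht⟩ := htest m (s m) fun _ => 0
    simp only [spread, Finset.univ_eq_empty, Finset.sum_empty, hN, Finset.sum_const_zero,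
      mul_zero, lt_self_iff_false] at ht
  let κ := Σ m, ι m (s m)
  have : Infinite κ := Infinite.of_injective (fun m => (⟨m, (hnon m).some⟩ : κ)) fun a b hab =>
    congrArg Sigma.fst hab
  obtain ⟨e⟩ : Nonempty (ℕ ≃ κ) := nonempty_equiv_of_countable
  refine ⟨fun i n => pos (e n).1 (s (e n).1) i (e n).2, fun i n => wt (e n).1 (s (e n).1) i (e n).2,
    ?_, fun i n => hwt _ _ _ _, fun m => ⟨ι m (s m), inst _ _, fun k => e.symm ⟨m, k⟩, ?_, ?_⟩⟩
  · have hinj' : ∀ (i i' : Fin 3) (x y : κ), pos x.1 (s x.1) i x.2 = pos y.1 (s y.1) i' y.2 →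
        i = i' ∧ x = y := by
      rintro i i' ⟨m, k⟩ ⟨m', k'⟩ hxy
      have h1 := hlt m i k
      have h2 := hlt m' i' k'
      have h3 := hM m (s m) i k
      have h4 := hM m' (s m') i' k'
      simp only at hxy
      have hmm : m = m' := by
        rcases lt_trichotomy m m' with hl | hl | hl
        · have := hsm (Nat.succ_le_of_lt hl)
          simp only [Nat.succ_eq_add_one] at this
          omega
        · exact hl
        · have := hsm (Nat.succ_le_of_lt hl)
          simp only [Nat.succ_eq_add_one] at this
          omega
      subst hmm
      have h5 := hinj m (s m) (a₁ := (i, k)) (a₂ := (i', k')) hxy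
      rw [Prod.mk.injEq] at h5
      exact ⟨h5.1, by rw [h5.2]⟩
    rintro ⟨i, n⟩ ⟨i', n'⟩ hnn
    obtain ⟨h1, h2⟩ := hinj' i i' (e n) (e n') hnn
    rw [h1, e.injective h2]
  · intro k k' hk
    exact eq_of_heq (Sigma.mk.inj (e.symm.injective hk)).2
  · intro c
    obtain ⟨i, t, ht0, ht⟩ := htest m (s m) fun k => c (e.symm ⟨m, k⟩)
    refine ⟨i, t, ht0, ?_⟩
    have h1 : ∀ i k, pos (e (e.symm ⟨m, k⟩)).1 (s (e (e.symm ⟨m, k⟩)).1) i (e (e.symm ⟨m, k⟩)).2 =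
        pos m (s m) i k := fun i k =>
      congrArg (fun x : κ => pos x.1 (s x.1) i x.2) (e.apply_symm_apply ⟨m, k⟩)
    have h2 : ∀ i k, wt (e (e.symm ⟨m, k⟩)).1 (s (e (e.symm ⟨m, k⟩)).1) i (e (e.symm ⟨m, k⟩)).2 =
        wt m (s m) i k := fun i k =>
      congrArg (fun x : κ => wt x.1 (s x.1) i x.2) (e.apply_symm_apply ⟨m, k⟩)
    simp only [h1, h2]
    exact ht

/-- The criterion: if the basis has competing families for all constants, then the closed span of
the planes which they define has no local unconditional structure. Indeed, an operator acting on
the planes which moves the line in the kernel of one of the forms maps a vector on which the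
corresponding family does not act to a vector on which it acts, and this family dominates. -/
theorem exists_subspace_of_competingFamilies
    (hmono : ∀ x y : ℕ →₀ ℝ, (∀ n, |x n| ≤ |y n|) → ‖J x‖ ≤ ‖J y‖)
    (hne : ∀ n, J (Finsupp.single n 1) ≠ 0)
    (h : ∀ (D : ℝ) (M : ℕ), HasCompetingFamilies (fun x => ‖J x‖) D M) :
    ∃ Y : Submodule ℝ X, IsClosed (Y : Set X) ∧ ¬ HasLocalUnconditionalStructure Y ∧
      HasUnconditionalDecomposition 2 Y ∧ HasGordonLewisProperty Y := by
  classical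
  obtain ⟨pos, wt, hinj, hwt, htest⟩ := exists_seq_competingFamilies (by simp) h
  obtain ⟨Y, hY⟩ : ∃ Y, Y = (LinearMap.range (J ∘ₗ planeSeq pos wt)).topologicalClosure := ⟨_, rfl⟩
  have hmem : ∀ z, (J ∘ₗ planeSeq pos wt) z ∈ Y := fun z => by
    rw [hY]
    exact Submodule.le_topologicalClosure _ ⟨z, rfl⟩
  have hΨ := isPlaneSystem_planeSeq hmono hne hinj hwt hY hmem
  refine ⟨Y, hY ▸ Submodule.isClosed_topologicalClosure _, fun hl => ?_,
    hΨ.hasUnconditionalDecomposition, hΨ.hasGordonLewisProperty⟩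
  obtain ⟨C, hC0, hC⟩ := hl.exists_diagonal hΨ
  obtain ⟨m, hm⟩ := exists_nat_ge (6 * C)
  obtain ⟨ι, _, g, hg, hc⟩ := htest m
  obtain ⟨T, c, hT, hbound⟩ := hC (Finset.univ.image g)
  obtain ⟨i, t, ht0, ht⟩ := hc c
  -- the image of a sequence of vectors of the planes
  have hval : ∀ u : ι → ℝ × ℝ, J (planeSeq pos wt (∑ k, Finsupp.single (g k) (u k))) =
      J (∑ i', spread (fun k => pos i' (g k)) fun k => wt i' (g k) * planeForm i' (u k)) := by
    intro u
    congr 1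
    rw [map_sum]
    simp only [planeSeq_single, spread]
    exact Finset.sum_comm
  have hnorm : ∀ v : ℕ → ℝ × ℝ,
      ‖∑ n ∈ Finset.univ.image g,
        planeEmb ((J ∘ₗ planeSeq pos wt).codRestrict Y hmem) n (v n)‖ =
      ‖J (∑ i', spread (fun k => pos i' (g k)) fun k => wt i' (g k) * planeForm i' (v (g k)))‖ := by
    intro v
    rw [← hval, Finset.sum_image fun a _ b _ hab => hg hab]
    simp only [planeEmb_apply]
    rw [← map_sum]
    rfl
  have hb := hbound (Function.extend g (fun k => t k • planeKer i) 0)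
  rw [hnorm fun n => T n (Function.extend g (fun k => t k • planeKer i) 0 n), hnorm] at hb
  simp only [hg.extend_apply, map_smul, smul_eq_mul] at hb
  have hinjg : ∀ i, Function.Injective fun k => pos i (g k) := fun i a b hab =>
    hg (Prod.ext_iff.mp (hinj (a₁ := (i, g a)) (a₂ := (i, g b)) hab)).2
  have hdisj : ∀ i' ≠ i, ∀ a b, pos i' (g a) ≠ pos i (g b) := fun i' hi a b hab =>
    hi (Prod.ext_iff.mp (hinj (a₁ := (i', g a)) (a₂ := (i, g b)) hab)).1
  have hupper : ‖J (∑ i', spread (fun k => pos i' (g k))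
        fun k => wt i' (g k) * (t k * planeForm i' (planeKer i)))‖ ≤
      ∑ i' ∈ Finset.univ.erase i,
        ‖J (spread (fun k => pos i' (g k)) fun k => wt i' (g k) * t k)‖ := by
    rw [map_sum, ← Finset.add_sum_erase _ _ (Finset.mem_univ i)]
    have h0 : spread (fun k => pos i (g k))
        (fun k => wt i (g k) * (t k * planeForm i (planeKer i))) = 0 := by
      simp [planeForm_planeKer_self, spread]
    rw [h0, map_zero, zero_add]
    refine (norm_sum_le _ _).trans (Finset.sum_le_sum fun i' hi => hmono _ _ fun n => ?_)
    have hi' := abs_planeForm_planeKer (Finset.ne_of_mem_erase hi)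
    by_cases hn : ∃ k, pos i' (g k) = n
    · obtain ⟨k, rfl⟩ := hn
      rw [spread_apply (hinjg i') _ k, spread_apply (hinjg i') _ k]
      rw [← mul_assoc, abs_mul _ (planeForm i' _), hi', mul_one]
    · push Not at hn
      rw [spread_apply_of_notMem _ hn, spread_apply_of_notMem _ hn]
  have hlower : 1 / 6 * ‖J (spread (fun k => pos i (g k)) fun k => wt i (g k) * t k)‖ ≤
      ‖J (∑ i', spread (fun k => pos i' (g k))
        fun k => wt i' (g k) * (t k * planeForm i' (T (g k) (planeKer i))))‖ := by
    have h6 : (1 / 6 : ℝ) = ‖(1 / 6 : ℝ)‖ := by norm_num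
    rw [h6, ← norm_smul, ← map_smul]
    refine hmono _ _ fun n => ?_
    by_cases hn : ∃ k, pos i (g k) = n
    · obtain ⟨k, rfl⟩ := hn
      rw [Finsupp.smul_apply, spread_apply (hinjg i) _ k, Finsupp.finsetSum_apply,
        Finset.sum_eq_single i]
      · rw [spread_apply (hinjg i) _ k, smul_eq_mul, mul_comm, ← mul_assoc, abs_mul, abs_mul _
          (planeForm i _)]
        by_cases hk : c (g k) = i
        · refine mul_le_mul_of_nonneg_left ?_ (abs_nonneg _)
          have h7 := hT (g k) (Finset.mem_image_of_mem g (Finset.mem_univ k))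
          rw [hk] at h7
          rw [abs_of_nonneg (by norm_num : (0 : ℝ) ≤ 1 / 6)]
          exact h7.trans (le_abs_self _)
        · simp [ht0 k hk]
      · intro i' _ hi
        exact spread_apply_of_notMem _ fun a => hdisj i' hi a k
      · simp
    · push Not at hn
      rw [Finsupp.smul_apply, spread_apply_of_notMem _ hn]
      simp
  have hfin := hlower.trans (hb.trans (mul_le_mul_of_nonneg_left hupper hC0))
  have hnn : 0 ≤ ∑ i' ∈ Finset.univ.erase i,
      ‖J (spread (fun k => pos i' (g k)) fun k => wt i' (g k) * t k)‖ :=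
    Finset.sum_nonneg fun _ _ => norm_nonneg _
  have h8 := mul_le_mul_of_nonneg_right hm hnn
  linarith

end Criterion

/-! ### Competing families in the convexified Tsirelson spaces -/

lemma spread_mul_left {ι : Type*} [Fintype ι] (g : ι → ℕ) (a : ℝ) (t : ι → ℝ) :
    (spread g fun k => a * t k) = a • spread g t := by
  simp [spread, Finset.smul_sum]

lemma spread_single {ι : Type*} [Fintype ι] [DecidableEq ι] (g : ι → ℕ) (w : ι → ℝ) (k : ι) :
    (spread g fun j => w j * (Pi.single k 1 : ι → ℝ) j) = Finsupp.single (g k) (w k) := by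
  rw [spread, Finset.sum_eq_single k]
  · simp
  · intro b _ hb
    simp [Pi.single_eq_of_ne hb]
  · simp

lemma TsirelsonRows.injective_pos {M : ℕ} {ε : ℕ → ℝ} {δ : ℝ} (R : TsirelsonRows M ε δ)
    (i : Fin 3) : Function.Injective (R.pos i) := fun a b hab =>
  (Prod.ext_iff.mp (R.injective (a₁ := (i, a)) (a₂ := (i, b)) hab)).2

/-- A labelling with two labels either is constant on some row or takes the first label at one
point of each row. -/
lemma TsirelsonRows.row_or_section {M : ℕ} {ε : ℕ → ℝ} {δ : ℝ} (R : TsirelsonRows M ε δ)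
    (P Q : R.ι → Prop) (h : ∀ k, P k ∨ Q k) :
    (∃ j < R.rows, ∀ k, R.row k = j → Q k) ∨
      ∃ s : ℕ → R.ι, (∀ j < R.rows, R.row (s j) = j) ∧ ∀ k, k = s (R.row k) → P k := by
  classical
  by_cases hrow : ∃ j < R.rows, ∀ k, R.row k = j → Q k
  · exact Or.inl hrow
  · push Not at hrow
    obtain ⟨k₀, -⟩ := hrow 0 R.rows_pos
    have : Nonempty R.ι := ⟨k₀⟩
    choose! s hs using hrow
    refine Or.inr ⟨s, fun j hj => (hs j hj).1, fun k hk => ?_⟩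
    rw [hk]
    exact (h _).resolve_right (hs _ (R.row_lt k)).2

section Primal

variable (p : ℝ) [Fact (1 ≤ p)]

lemma convTsirelsonNorm_mono {x y : ℕ →₀ ℝ} (h : ∀ n, |x n| ≤ |y n|) :
    convTsirelsonNorm p x ≤ convTsirelsonNorm p y := by
  have hp : (1 : ℝ) ≤ p := Fact.out
  refine convTsirelsonNorm_le p (convTsirelsonNorm_nonneg p y) ?_
  rw [convTsirelsonNorm_rpow]
  refine isLatticeSeminorm_tsirelsonNorm.mono _ _ fun n => ?_
  simp only [absPow_apply]
  rw [abs_of_nonneg (show (0 : ℝ) ≤ |x n| ^ p by positivity),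
    abs_of_nonneg (show (0 : ℝ) ≤ |y n| ^ p by positivity)]
  exact Real.rpow_le_rpow (abs_nonneg _) (h n) (by linarith)

lemma convTsirelsonNorm_single (n : ℕ) (a : ℝ) :
    convTsirelsonNorm p (Finsupp.single n a) = |a| := by
  have hp : (1 : ℝ) ≤ p := Fact.out
  refine le_antisymm (convTsirelsonNorm_le p (abs_nonneg a) ?_) ?_
  · have h1 : absPow p (Finsupp.single n a) = Finsupp.single n (|a| ^ p) := by
      simp [absPow]
    rw [h1]
    refine (isLatticeSeminorm_tsirelsonNorm.le_ellOne _).trans_eq ?_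
    rw [ellOne_eq (s := {n}) Finsupp.support_single_subset, Finset.sum_singleton,
      Finsupp.single_eq_same, abs_of_nonneg (by positivity)]
  · simpa using abs_le_convTsirelsonNorm p (Finsupp.single n a) n

variable {ι : Type*} [Fintype ι] {g : ι → ℕ} {r : ι → ℝ}

lemma absPow_spread_rpow (hg : Function.Injective g) (hr : ∀ k, 0 ≤ r k) :
    absPow p (spread g fun k => r k ^ (1 / p)) = spread g r := by
  have hp : (1 : ℝ) ≤ p := Fact.out
  have hp0 : p ≠ 0 := by linarith
  ext n
  rw [absPow_apply]
  by_cases hn : ∃ k, g k = n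
  · obtain ⟨k, rfl⟩ := hn
    rw [spread_apply hg _ k, spread_apply hg, abs_of_nonneg (Real.rpow_nonneg (hr k) _),
      ← Real.rpow_mul (hr k), one_div_mul_cancel hp0, Real.rpow_one]
  · push Not at hn
    rw [spread_apply_of_notMem _ hn, spread_apply_of_notMem _ hn, abs_zero,
      Real.zero_rpow hp0]

lemma convTsirelsonNorm_spread_le (hg : Function.Injective g) (hr : ∀ k, 0 ≤ r k) {e : ℝ}
    (he : 0 ≤ e) (h : tsirelsonNorm (spread g r) ≤ e ^ p) :
    convTsirelsonNorm p (spread g fun k => r k ^ (1 / p)) ≤ e :=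
  convTsirelsonNorm_le p he (by rwa [absPow_spread_rpow p hg hr])

lemma convTsirelsonNorm_spread_le_one (hg : Function.Injective g) (hr : ∀ k, 0 ≤ r k)
    (h1 : ∑ k, r k = 1) : convTsirelsonNorm p (spread g fun k => r k ^ (1 / p)) ≤ 1 := by
  refine convTsirelsonNorm_spread_le p hg hr zero_le_one ?_
  rw [Real.one_rpow, ← h1]
  exact (tsirelsonNorm_spread_le g r).trans_eq
    (Finset.sum_congr rfl fun k _ => abs_of_nonneg (hr k))

lemma half_le_convTsirelsonNorm_spread (hg : Function.Injective g) (hr : ∀ k, 0 ≤ r k)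
    (h1 : ∑ k, r k = 1) (h : ∑ k, |r k| ≤ 2 * tsirelsonNorm (spread g r)) :
    1 / 2 ≤ convTsirelsonNorm p (spread g fun k => r k ^ (1 / p)) := by
  have hp : (1 : ℝ) ≤ p := Fact.out
  rw [Finset.sum_congr rfl fun k _ => abs_of_nonneg (hr k), h1, ← absPow_spread_rpow p hg hr,
    ← convTsirelsonNorm_rpow] at h
  refine (Real.rpow_le_rpow_iff (by norm_num) (convTsirelsonNorm_nonneg p _)
    (by linarith : 0 < p)).mp ?_
  have h2 : (1 / 2 : ℝ) ^ p ≤ (1 / 2) ^ (1 : ℝ) :=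
    Real.rpow_le_rpow_of_exponent_ge (by norm_num) (by norm_num) hp
  rw [Real.rpow_one] at h2
  linarith

/-- In `T_(p)` the family which is small on rows gets the weight `1`, the family which is small
only on sections of the rows a small weight `δ`, and the family which behaves like `ℓ_p` the
weight `δ ^ 2`. They dominate on single vectors, on rows, and on sections, respectively. -/
theorem hasCompetingFamilies_convTsirelsonNorm (D : ℝ) (M : ℕ) :
    HasCompetingFamilies (convTsirelsonNorm p) D M := by
  classical
  have hp : (1 : ℝ) ≤ p := Fact.out
  obtain ⟨D₀, hD₀, hD₁⟩ : ∃ D₀, D ≤ D₀ ∧ 1 ≤ D₀ := ⟨max D 1, le_max_left _ _, le_max_right _ _⟩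
  obtain ⟨δ, hδ⟩ : ∃ δ, δ = 1 / (8 * D₀) := ⟨_, rfl⟩
  have hδ0 : 0 < δ := by rw [hδ]; positivity
  have hDδ : D₀ * δ = 1 / 8 := by rw [hδ]; field_simp
  have hδ1 : δ ≤ 1 / 8 := by nlinarith
  obtain ⟨R⟩ := nonempty_tsirelsonRows M (ε := fun _ => (δ ^ 3) ^ p) (δ := (δ ^ 3) ^ p)
    (fun _ => by positivity) (by positivity)
  have hinj := R.injective_pos
  have hconst : ∀ (i : Fin 3) (a : ℝ), 0 < a → ∀ t : R.ι → ℝ,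
      convTsirelsonNorm p (spread (R.pos i) fun k => a * t k) =
        a * convTsirelsonNorm p (spread (R.pos i) t) := fun i a ha t => by
    rw [spread_mul_left, convTsirelsonNorm_smul, abs_of_pos ha]
  refine ⟨R.ι, R.fintype, R.pos, fun i _ => ![δ ^ 2, δ, 1] i, R.injective, R.le_pos, fun i k => ?_,
    fun c => ?_⟩
  · fin_cases i <;> simp <;> positivity
  have hD : ∀ x : ℝ, 0 ≤ x → D * x ≤ D₀ * x := fun x hx => mul_le_mul_of_nonneg_right hD₀ hx
  have e0 : (Finset.univ : Finset (Fin 3)).erase 0 = {1, 2} := by decide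
  have e1 : (Finset.univ : Finset (Fin 3)).erase 1 = {0, 2} := by decide
  have e2 : (Finset.univ : Finset (Fin 3)).erase 2 = {0, 1} := by decide
  by_cases h2 : ∃ k, c k = 2
  · obtain ⟨k, hk⟩ := h2
    refine ⟨2, Pi.single k 1, fun j hj =>
      Pi.single_eq_of_ne (fun h : j = k => hj (by rw [h, hk])) _, ?_⟩
    rw [e2, Finset.sum_pair (by decide)]
    simp only [spread_single _ (fun _ => _), convTsirelsonNorm_single]
    change D * (|δ ^ 2| + |δ|) < |1|
    rw [abs_of_pos hδ0, abs_of_pos (by positivity : 0 < δ ^ 2), abs_one]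
    have := hD (δ ^ 2 + δ) (by positivity)
    nlinarith
  · push Not at h2
    rcases R.row_or_section (fun k => c k = 0) (fun k => c k = 1) (fun k => by
      have := h2 k
      generalize c k = i at *
      fin_cases i <;> simp at this ⊢) with ⟨j, hj, hc⟩ | ⟨s, hs, hc⟩
    · obtain ⟨r, hr0, hrs, hr1, hr⟩ := R.exists_row j hj
      refine ⟨1, fun k => r k ^ (1 / p), fun k hk => ?_, ?_⟩
      · have : R.row k ≠ j := fun h => hk (hc k h)
        simp only [hrs k this]
        exact Real.zero_rpow (by positivity)
      · have a2 := convTsirelsonNorm_spread_le p (hinj 2) hr0 (by positivity) hr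
        have a1 := half_le_convTsirelsonNorm_spread p (hinj 1) hr0 hr1 (R.row_large j r hrs)
        have a0 := convTsirelsonNorm_spread_le_one p (hinj 0) hr0 hr1
        rw [e1, Finset.sum_pair (by decide)]
        change D * (convTsirelsonNorm p (spread (R.pos 0) fun k => δ ^ 2 * r k ^ (1 / p)) +
          convTsirelsonNorm p (spread (R.pos 2) fun k => 1 * r k ^ (1 / p))) <
          convTsirelsonNorm p (spread (R.pos 1) fun k => δ * r k ^ (1 / p))
        rw [hconst 0 _ (by positivity), hconst 2 _ one_pos, hconst 1 _ hδ0, one_mul]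
        have n0 := convTsirelsonNorm_nonneg p (spread (R.pos 0) fun k => r k ^ (1 / p))
        have n2 := convTsirelsonNorm_nonneg p (spread (R.pos 2) fun k => r k ^ (1 / p))
        refine (hD _ (by positivity)).trans_lt ?_
        calc _ ≤ D₀ * (δ ^ 2 * 1 + δ ^ 3) := by gcongr
          _ = (D₀ * δ) * (δ + δ ^ 2) := by ring
          _ < δ * (1 / 2) := by rw [hDδ]; nlinarith
          _ ≤ _ := by gcongr
    · obtain ⟨r, hr0, hrs, hr1, hr, hr'⟩ := R.exists_col s hs
      refine ⟨0, fun k => r k ^ (1 / p), fun k hk => ?_, ?_⟩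
      · have : k ≠ s (R.row k) := fun h => hk (hc k h)
        simp only [hrs k this]
        exact Real.zero_rpow (by positivity)
      · have a2 := convTsirelsonNorm_spread_le p (hinj 2) hr0 (by positivity) hr'
        have a1 := convTsirelsonNorm_spread_le p (hinj 1) hr0 (by positivity) hr
        have a0 := half_le_convTsirelsonNorm_spread p (hinj 0) hr0 hr1 (R.large r)
        rw [e0, Finset.sum_pair (by decide)]
        change D * (convTsirelsonNorm p (spread (R.pos 1) fun k => δ * r k ^ (1 / p)) +
          convTsirelsonNorm p (spread (R.pos 2) fun k => 1 * r k ^ (1 / p))) <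
          convTsirelsonNorm p (spread (R.pos 0) fun k => δ ^ 2 * r k ^ (1 / p))
        rw [hconst 0 _ (by positivity), hconst 2 _ one_pos, hconst 1 _ hδ0, one_mul]
        have n1 := convTsirelsonNorm_nonneg p (spread (R.pos 1) fun k => r k ^ (1 / p))
        have n2 := convTsirelsonNorm_nonneg p (spread (R.pos 2) fun k => r k ^ (1 / p))
        refine (hD _ (by positivity)).trans_lt ?_
        calc _ ≤ D₀ * (δ * δ ^ 3 + δ ^ 3) := by gcongr
          _ = (D₀ * δ) * (δ ^ 2 * (δ + 1)) := by ring
          _ < δ ^ 2 * (1 / 2) := by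
            rw [hDδ]
            have : 0 < δ ^ 2 := by positivity
            nlinarith
          _ ≤ _ := by gcongr

/-- The basis of `T_(p)` as a linear map on the finitely supported sequences. -/
def toConvTsirelson : (ℕ →₀ ℝ) →ₗ[ℝ] ConvTsirelson p :=
  (UniformSpace.Completion.toComplₗᵢ (𝕜 := ℝ) (E := PreTsirelson p)).toLinearMap

lemma norm_toConvTsirelson (x : ℕ →₀ ℝ) : ‖toConvTsirelson p x‖ = convTsirelsonNorm p x :=
  UniformSpace.Completion.norm_coe (E := PreTsirelson p) x

lemma denseRange_toConvTsirelson : DenseRange (toConvTsirelson p) :=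
  UniformSpace.Completion.denseRange_coe (α := PreTsirelson p)

end Primal

/-! ### Competing families in the duals -/

section Dual

variable (p : ℝ) [Fact (1 ≤ p)]

/-- The `n`-th coordinate functional on `T_(p)`. -/
def coordFunctional (n : ℕ) : StrongDual ℝ (ConvTsirelson p) :=
  (Finsupp.lapply n : (ℕ →₀ ℝ) →ₗ[ℝ] ℝ).extendOfNorm (toConvTsirelson p)

lemma coordFunctional_apply (n : ℕ) (x : ℕ →₀ ℝ) :
    coordFunctional p n (toConvTsirelson p x) = x n :=
  LinearMap.extendOfNorm_eq (f := (Finsupp.lapply n : (ℕ →₀ ℝ) →ₗ[ℝ] ℝ))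
    (denseRange_toConvTsirelson p)
    ⟨1, fun y => by
      rw [one_mul, norm_toConvTsirelson]
      exact abs_le_convTsirelsonNorm p y n⟩ x

/-- The biorthogonal functionals of `T_(p)` as a linear map on the finitely supported
sequences. -/
def toDualConvTsirelson : (ℕ →₀ ℝ) →ₗ[ℝ] StrongDual ℝ (ConvTsirelson p) :=
  Finsupp.linearCombination ℝ (coordFunctional p)

lemma toDualConvTsirelson_single (n : ℕ) (a : ℝ) (x : ℕ →₀ ℝ) :
    toDualConvTsirelson p (Finsupp.single n a) (toConvTsirelson p x) = a * x n := by
  simp [toDualConvTsirelson, coordFunctional_apply]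

lemma toDualConvTsirelson_apply (s x : ℕ →₀ ℝ) {A : Finset ℕ} (hA : s.support ⊆ A) :
    toDualConvTsirelson p s (toConvTsirelson p x) = ∑ n ∈ A, s n * x n := by
  rw [toDualConvTsirelson, Finsupp.linearCombination_apply,
    Finsupp.sum_of_support_subset _ hA _ (by simp), sum_apply]
  simp [coordFunctional_apply]

lemma toDualConvTsirelson_spread {ι : Type*} [Fintype ι] (g : ι → ℕ) (t : ι → ℝ) (x : ℕ →₀ ℝ) :
    toDualConvTsirelson p (spread g t) (toConvTsirelson p x) = ∑ k, t k * x (g k) := by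
  rw [spread, map_sum, sum_apply]
  simp [toDualConvTsirelson_single]

lemma norm_toDualConvTsirelson_le {s : ℕ →₀ ℝ} {K : ℝ} (hK : 0 ≤ K)
    (h : ∀ x, |toDualConvTsirelson p s (toConvTsirelson p x)| ≤ K * convTsirelsonNorm p x) :
    ‖toDualConvTsirelson p s‖ ≤ K := by
  refine ContinuousLinearMap.opNorm_le_bound _ hK fun z => ?_
  refine (denseRange_toConvTsirelson p).induction_on (p := fun z =>
    ‖toDualConvTsirelson p s z‖ ≤ K * ‖z‖) z (isClosed_le (by fun_prop) (by fun_prop)) fun x => ?_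
  rw [norm_toConvTsirelson]
  exact h x

lemma abs_toDualConvTsirelson_le (s x : ℕ →₀ ℝ) :
    |toDualConvTsirelson p s (toConvTsirelson p x)| ≤
      ‖toDualConvTsirelson p s‖ * convTsirelsonNorm p x := by
  rw [← norm_toConvTsirelson]
  exact (toDualConvTsirelson p s).le_opNorm _

lemma norm_toDualConvTsirelson_mono {s s' : ℕ →₀ ℝ} (h : ∀ n, |s n| ≤ |s' n|) :
    ‖toDualConvTsirelson p s‖ ≤ ‖toDualConvTsirelson p s'‖ := by
  refine norm_toDualConvTsirelson_le p (norm_nonneg _) fun x => ?_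
  -- the multiplier `s / s'` is moved from the functional to the vector
  obtain ⟨y, hy⟩ : ∃ y : ℕ →₀ ℝ, ∀ n, y n = s n / s' n * x n :=
    ⟨Finsupp.onFinset x.support (fun n => s n / s' n * x n)
      fun n hn => Finsupp.mem_support_iff.mpr fun hx => hn (by rw [hx, mul_zero]), fun _ => rfl⟩
  have h1 : toDualConvTsirelson p s (toConvTsirelson p x) =
      toDualConvTsirelson p s' (toConvTsirelson p y) := by
    rw [toDualConvTsirelson_apply p s x (A := s.support ∪ s'.support) Finset.subset_union_left,
      toDualConvTsirelson_apply p s' y (A := s.support ∪ s'.support) Finset.subset_union_right]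
    refine Finset.sum_congr rfl fun n _ => ?_
    rw [hy]
    by_cases h0 : s' n = 0
    · have := h n
      rw [h0, abs_zero, abs_nonpos_iff] at this
      rw [this, h0]
      simp
    · field_simp
  rw [h1]
  refine (abs_toDualConvTsirelson_le p s' y).trans
    (mul_le_mul_of_nonneg_left (convTsirelsonNorm_mono p fun n => ?_) (norm_nonneg _))
  rw [hy, abs_mul, abs_div]
  exact mul_le_of_le_one_left (abs_nonneg _) (div_le_one_of_le₀ (h n) (abs_nonneg _))

lemma norm_toDualConvTsirelson_single (n : ℕ) (a : ℝ) :
    ‖toDualConvTsirelson p (Finsupp.single n a)‖ = |a| := by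
  refine le_antisymm (norm_toDualConvTsirelson_le p (abs_nonneg a) fun x => ?_) ?_
  · rw [toDualConvTsirelson_single, abs_mul]
    exact mul_le_mul_of_nonneg_left (abs_le_convTsirelsonNorm p x n) (abs_nonneg a)
  · have h := abs_toDualConvTsirelson_le p (Finsupp.single n a) (Finsupp.single n 1)
    rw [toDualConvTsirelson_single, convTsirelsonNorm_single] at h
    simpa using h

section Spread

variable {ι : Type*} [Fintype ι] {g : ι → ℕ} {r : ι → ℝ} {q : ℝ}

lemma norm_toDualConvTsirelson_spread_le (g : ι → ℕ) (t : ι → ℝ) :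
    ‖toDualConvTsirelson p (spread g t)‖ ≤ ∑ k, |t k| := by
  rw [spread, map_sum]
  refine (norm_sum_le _ _).trans_eq (Finset.sum_congr rfl fun k _ => ?_)
  exact norm_toDualConvTsirelson_single p (g k) (t k)

/-- A normalized vector which is small in `T_(p)` is normed by the corresponding functional, which
is therefore large. -/
lemma one_div_le_norm_toDualConvTsirelson_spread (hpq : p.HolderConjugate q)
    (hg : Function.Injective g) (hr : ∀ k, 0 ≤ r k) (h1 : ∑ k, r k = 1) {e : ℝ} (he : 0 < e)
    (h : tsirelsonNorm (spread g r) ≤ e ^ p) :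
    1 / e ≤ ‖toDualConvTsirelson p (spread g fun k => r k ^ (1 / q))‖ := by
  have h2 := abs_toDualConvTsirelson_le p (spread g fun k => r k ^ (1 / q))
    (spread g fun k => r k ^ (1 / p))
  rw [toDualConvTsirelson_spread] at h2
  have h3 : ∀ k, r k ^ (1 / q) * spread g (fun k => r k ^ (1 / p)) (g k) = r k := fun k => by
    have hpq1 : 1 / q + 1 / p = 1 := by
      have := hpq.inv_add_inv_eq_one
      rw [one_div, one_div]
      linarith
    rw [spread_apply hg _ k, ← Real.rpow_add_of_nonneg (hr k) hpq.symm.one_div_nonneg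
      hpq.one_div_nonneg, hpq1, Real.rpow_one]
  rw [Finset.sum_congr rfl fun k _ => h3 k, h1, abs_one] at h2
  rw [div_le_iff₀ he]
  exact h2.trans (mul_le_mul_of_nonneg_left (convTsirelsonNorm_spread_le p hg hr he.le h)
    (norm_nonneg _))

/-- Where the norm of `T_(p)` behaves like that of `ℓ_p`, the dual norm behaves like that of
`ℓ_q`. -/
lemma norm_toDualConvTsirelson_spread_le_two (hpq : p.HolderConjugate q)
    (hg : Function.Injective g) (hr : ∀ k, 0 ≤ r k) (h1 : ∑ k, r k = 1)
    (h : ∀ a : ι → ℝ, (∀ k, r k = 0 → a k = 0) → ∑ k, |a k| ≤ 2 * tsirelsonNorm (spread g a)) :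
    ‖toDualConvTsirelson p (spread g fun k => r k ^ (1 / q))‖ ≤ 2 := by
  classical
  refine norm_toDualConvTsirelson_le p (by norm_num) fun x => ?_
  have hp : (1 : ℝ) ≤ p := Fact.out
  have hN := convTsirelsonNorm_nonneg p x
  rw [toDualConvTsirelson_spread]
  obtain ⟨y, hy⟩ : ∃ y : ι → ℝ, ∀ k, y k = if r k = 0 then 0 else |x (g k)| := ⟨_, fun _ => rfl⟩
  have hy0 : ∀ k, 0 ≤ y k := fun k => by rw [hy]; split_ifs <;> positivity
  have hyx : ∀ k, y k ≤ |x (g k)| := fun k => by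
    rw [hy]
    split_ifs
    · exact abs_nonneg _
    · exact le_rfl
  have hsum : ∑ k, |y k| ^ p ≤ (2 * convTsirelsonNorm p x) ^ p := by
    have h2 := h (fun k => |y k| ^ p) fun k hk => by
      rw [hy, if_pos hk, abs_zero, Real.zero_rpow hpq.ne_zero]
    have h3 : tsirelsonNorm (spread g fun k => |y k| ^ p) ≤ convTsirelsonNorm p x ^ p := by
      rw [convTsirelsonNorm_rpow]
      refine isLatticeSeminorm_tsirelsonNorm.mono _ _ fun n => ?_
      by_cases hn : ∃ k, g k = n
      · obtain ⟨k, rfl⟩ := hn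
        rw [spread_apply hg _ k, absPow_apply, abs_of_nonneg (hy0 k),
          abs_of_nonneg (Real.rpow_nonneg (hy0 k) _),
          abs_of_nonneg (show 0 ≤ |x (g k)| ^ p by positivity)]
        exact Real.rpow_le_rpow (hy0 k) (hyx k) (by linarith)
      · push Not at hn
        rw [spread_apply_of_notMem _ hn, abs_zero]
        exact abs_nonneg _
    rw [Finset.sum_congr rfl fun k _ => abs_of_nonneg (by positivity : 0 ≤ |y k| ^ p)] at h2
    have h4 : (2 : ℝ) ≤ 2 ^ p := by
      simpa using Real.rpow_le_rpow_of_exponent_le (by norm_num : (1 : ℝ) ≤ 2) hp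
    rw [Real.mul_rpow (by norm_num) hN]
    calc _ ≤ _ := h2
      _ ≤ 2 * convTsirelsonNorm p x ^ p := by gcongr
      _ ≤ _ := by gcongr
  calc |∑ k, r k ^ (1 / q) * x (g k)| ≤ ∑ k, r k ^ (1 / q) * y k := by
        refine (Finset.abs_sum_le_sum_abs _ _).trans (Finset.sum_le_sum fun k _ => ?_)
        rw [abs_mul, abs_of_nonneg (Real.rpow_nonneg (hr k) _), hy]
        split_ifs with hk
        · rw [hk, Real.zero_rpow (one_div_ne_zero hpq.symm.ne_zero), zero_mul, zero_mul]
        · exact le_rfl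
    _ ≤ (∑ k, |r k ^ (1 / q)| ^ q) ^ (1 / q) * (∑ k, |y k| ^ p) ^ (1 / p) :=
        Real.inner_le_Lp_mul_Lq _ _ _ hpq.symm
    _ = (∑ k, |y k| ^ p) ^ (1 / p) := by
        have h5 : ∀ k, |r k ^ (1 / q)| ^ q = r k := fun k => by
          rw [abs_of_nonneg (Real.rpow_nonneg (hr k) _), ← Real.rpow_mul (hr k),
            one_div_mul_cancel hpq.symm.ne_zero, Real.rpow_one]
        rw [Finset.sum_congr rfl fun k _ => h5 k, h1, Real.one_rpow, one_mul]
    _ ≤ ((2 * convTsirelsonNorm p x) ^ p) ^ (1 / p) := by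
        gcongr
    _ = 2 * convTsirelsonNorm p x := by
        rw [← Real.rpow_mul (by positivity), mul_one_div_cancel hpq.ne_zero, Real.rpow_one]

end Spread

/-- In the dual of `T_(p)` the order of the weights is reversed: a family is large where it is
small in `T_(p)`.  The family which behaves like `ℓ_p` gets the weight `1`, the family which is
small on sections gets a small weight `δ`, and the family which is small on rows gets weights which
are constant on rows, and decrease so fast from row to row that sections do not count. -/
theorem hasCompetingFamilies_toDualConvTsirelson (hp : 1 < p) (D : ℝ) (M : ℕ) :
    HasCompetingFamilies (fun x => ‖toDualConvTsirelson p x‖) D M := by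
  classical
  obtain ⟨q, hpq⟩ : ∃ q, p.HolderConjugate q := ⟨_, Real.HolderConjugate.conjExponent hp⟩
  have hq0 := hpq.symm.one_div_pos
  obtain ⟨D₀, hD₀, hD₁⟩ : ∃ D₀, D ≤ D₀ ∧ 1 ≤ D₀ := ⟨max D 1, le_max_left _ _, le_max_right _ _⟩
  obtain ⟨δ, hδ⟩ : ∃ δ, δ = 1 / (8 * D₀) := ⟨_, rfl⟩
  have hδ0 : 0 < δ := by rw [hδ]; positivity
  have hDδ : D₀ * δ = 1 / 8 := by rw [hδ]; field_simp
  have hδ1 : δ ≤ 1 / 8 := by nlinarith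
  have hδD : 1 / δ = 8 * D₀ := by rw [hδ, one_div_one_div]
  obtain ⟨R⟩ := nonempty_tsirelsonRows M (ε := fun j => (δ ^ 2 / 2 ^ j) ^ p) (δ := (δ ^ 2) ^ p)
    (fun _ => by positivity) (by positivity)
  have hinj := R.injective_pos
  have hconst : ∀ (i : Fin 3) (a : ℝ), 0 < a → ∀ t : R.ι → ℝ,
      ‖toDualConvTsirelson p (spread (R.pos i) fun k => a * t k)‖ =
        a * ‖toDualConvTsirelson p (spread (R.pos i) t)‖ := fun i a ha t => by
    rw [spread_mul_left, map_smul, norm_smul, Real.norm_of_nonneg ha.le]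
  have hD : ∀ x : ℝ, 0 ≤ x → D * x ≤ D₀ * x := fun x hx => mul_le_mul_of_nonneg_right hD₀ hx
  have hend : ∀ x y z : ℝ, 0 ≤ x → 0 ≤ y → x + y ≤ 2 + 2 * δ → 1 / δ ≤ z →
      D * (x + y) < z := fun x y z hx hy hxy hz => by
    calc D * (x + y) ≤ D₀ * (x + y) := hD _ (by positivity)
      _ ≤ D₀ * (2 + 2 * δ) := by gcongr
      _ < 8 * D₀ := by nlinarith
      _ ≤ z := hδD ▸ hz
  have e0 : (Finset.univ : Finset (Fin 3)).erase 0 = {1, 2} := by decide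
  have e1 : (Finset.univ : Finset (Fin 3)).erase 1 = {0, 2} := by decide
  have e2 : (Finset.univ : Finset (Fin 3)).erase 2 = {0, 1} := by decide
  have hw : ∀ j : ℕ, 0 < δ / 2 ^ j := fun j => by positivity
  refine ⟨R.ι, R.fintype, R.pos, fun i k => ![1, δ, δ / 2 ^ R.row k] i, R.injective, R.le_pos,
    fun i k => ?_, fun c => ?_⟩
  · fin_cases i <;> simp <;> positivity
  by_cases h0 : ∃ k, c k = 0
  · obtain ⟨k, hk⟩ := h0
    refine ⟨0, Pi.single k 1, fun j hj =>
      Pi.single_eq_of_ne (fun h : j = k => hj (by rw [h, hk])) _, ?_⟩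
    rw [e0, Finset.sum_pair (by decide)]
    simp only [spread_single, norm_toDualConvTsirelson_single]
    change D * (|δ| + |δ / 2 ^ R.row k|) < |1|
    rw [abs_of_pos hδ0, abs_of_pos (hw _), abs_one]
    have h2 : δ / 2 ^ R.row k ≤ δ := div_le_self hδ0.le (one_le_pow₀ (by norm_num))
    have := hD (δ + δ / 2 ^ R.row k) (by have := hw (R.row k); positivity)
    nlinarith
  · push Not at h0
    rcases R.row_or_section (fun k => c k = 1) (fun k => c k = 2) (fun k => by
      have := h0 k
      generalize c k = i at *
      fin_cases i <;> simp at this ⊢) with ⟨j, hj, hc⟩ | ⟨s, hs, hc⟩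
    · obtain ⟨r, hr0, hrs, hr1, hr⟩ := R.exists_row j hj
      have hr' : ∀ k, R.row k ≠ j → r k ^ (1 / q) = 0 := fun k hk => by
        rw [hrs k hk, Real.zero_rpow hq0.ne']
      refine ⟨2, fun k => r k ^ (1 / q), fun k hk => hr' k fun h => hk (hc k h), ?_⟩
      have a2 := one_div_le_norm_toDualConvTsirelson_spread p hpq (hinj 2) hr0 hr1
        (by positivity) hr
      have a1 := norm_toDualConvTsirelson_spread_le_two p hpq (hinj 1) hr0 hr1
        fun a ha => R.row_large j a fun k hk => ha k (hrs k hk)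
      have a0 := norm_toDualConvTsirelson_spread_le_two p hpq (hinj 0) hr0 hr1
        fun a _ => R.large a
      rw [e2, Finset.sum_pair (by decide)]
      change D * (‖toDualConvTsirelson p (spread (R.pos 0) fun k => 1 * r k ^ (1 / q))‖ +
        ‖toDualConvTsirelson p (spread (R.pos 1) fun k => δ * r k ^ (1 / q))‖) <
        ‖toDualConvTsirelson p (spread (R.pos 2) fun k => δ / 2 ^ R.row k * r k ^ (1 / q))‖
      have hrow : (fun k => δ / 2 ^ R.row k * r k ^ (1 / q)) =
          fun k => δ / 2 ^ j * r k ^ (1 / q) := by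
        ext k
        by_cases hk : R.row k = j
        · rw [hk]
        · rw [hr' k hk, mul_zero, mul_zero]
      rw [hrow, hconst 0 _ one_pos, hconst 1 _ hδ0, hconst 2 _ (hw j), one_mul]
      refine hend _ _ _ (norm_nonneg _) (by positivity) ?_ ?_
      · nlinarith
      · calc 1 / δ = δ / 2 ^ j * (1 / (δ ^ 2 / 2 ^ j)) := by field_simp
          _ ≤ _ := mul_le_mul_of_nonneg_left a2 (hw j).le
    · obtain ⟨r, hr0, hrs, hr1, hr, -⟩ := R.exists_col s hs
      have hr' : ∀ k, k ≠ s (R.row k) → r k ^ (1 / q) = 0 := fun k hk => by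
        rw [hrs k hk, Real.zero_rpow hq0.ne']
      refine ⟨1, fun k => r k ^ (1 / q), fun k hk => hr' k fun h => hk (hc k h), ?_⟩
      have a1 := one_div_le_norm_toDualConvTsirelson_spread p hpq (hinj 1) hr0 hr1
        (by positivity) hr
      have a0 := norm_toDualConvTsirelson_spread_le_two p hpq (hinj 0) hr0 hr1
        fun a _ => R.large a
      have a2 : ‖toDualConvTsirelson p
          (spread (R.pos 2) fun k => δ / 2 ^ R.row k * r k ^ (1 / q))‖ ≤ 2 * δ := by
        refine (norm_toDualConvTsirelson_spread_le p _ _).trans ?_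
        have hle : ∀ k, |δ / 2 ^ R.row k * r k ^ (1 / q)| ≤
            if k = s (R.row k) then δ * (1 / 2) ^ R.row k else 0 := fun k => by
          split_ifs with hk
          · have : r k ≤ 1 := hr1 ▸ Finset.single_le_sum (fun k _ => hr0 k) (Finset.mem_univ k)
            rw [abs_of_nonneg (mul_nonneg (hw _).le (Real.rpow_nonneg (hr0 k) _)), one_div_pow,
              mul_one_div]
            exact mul_le_of_le_one_right (hw _).le (Real.rpow_le_one (hr0 k) this hq0.le)
          · rw [hr' k hk, mul_zero, abs_zero]
        refine (Finset.sum_le_sum fun k _ => hle k).trans ?_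
        rw [← Finset.sum_filter]
        -- a section meets each row once, so the weights on it form part of a geometric series
        rw [← Finset.sum_image (s := Finset.univ.filter fun k => k = s (R.row k)) (g := R.row)
          (f := fun j => δ * (1 / 2) ^ j) fun k hk k' hk' h => by
            rw [(Finset.mem_filter.mp hk).2, (Finset.mem_filter.mp hk').2, h]]
        refine (Finset.sum_le_sum_of_subset_of_nonneg (t := Finset.range R.rows) (fun j hj => ?_)
          fun _ _ _ => by positivity).trans ?_
        · obtain ⟨k, -, rfl⟩ := Finset.mem_image.mp hj
          exact Finset.mem_range.mpr (R.row_lt k)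
        · rw [← Finset.mul_sum, mul_comm 2 δ]
          exact mul_le_mul_of_nonneg_left (sum_geometric_two_le _) hδ0.le
      rw [e1, Finset.sum_pair (by decide)]
      change D * (‖toDualConvTsirelson p (spread (R.pos 0) fun k => 1 * r k ^ (1 / q))‖ +
        ‖toDualConvTsirelson p (spread (R.pos 2) fun k => δ / 2 ^ R.row k * r k ^ (1 / q))‖) <
        ‖toDualConvTsirelson p (spread (R.pos 1) fun k => δ * r k ^ (1 / q))‖
      rw [hconst 0 _ one_pos, hconst 1 _ hδ0, one_mul]
      refine hend _ _ _ (norm_nonneg _) (norm_nonneg _) (by linarith) ?_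
      calc 1 / δ = δ * (1 / δ ^ 2) := by field_simp
        _ ≤ _ := mul_le_mul_of_nonneg_left a1 hδ0.le

end Dual

end

theorem corollary4p5 (p : ℝ) [Fact (1 ≤ p)] :
    (∃ Y : Submodule ℝ (ConvTsirelson p), IsClosed (Y : Set (ConvTsirelson p)) ∧
      ¬ HasLocalUnconditionalStructure Y ∧
      HasUnconditionalDecomposition 2 Y ∧
      HasGordonLewisProperty Y) ∧
    (1 < p →
      ∃ Y : Submodule ℝ (StrongDual ℝ (ConvTsirelson p)),
        IsClosed (Y : Set (StrongDual ℝ (ConvTsirelson p))) ∧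
        ¬ HasLocalUnconditionalStructure Y ∧
        HasUnconditionalDecomposition 2 Y ∧
        HasGordonLewisProperty Y) := by
  refine ⟨exists_subspace_of_competingFamilies (J := toConvTsirelson p) (fun x y h => ?_)
    (fun n => ?_) fun D M => ?_, fun hp => exists_subspace_of_competingFamilies
      (J := toDualConvTsirelson p) (fun x y h => norm_toDualConvTsirelson_mono p h) (fun n => ?_)
      (hasCompetingFamilies_toDualConvTsirelson p hp)⟩
  · rw [norm_toConvTsirelson, norm_toConvTsirelson]
    exact convTsirelsonNorm_mono p h
  · rw [← norm_ne_zero_iff, norm_toConvTsirelson, convTsirelsonNorm_single, abs_one]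
    exact one_ne_zero
  · simp_rw [norm_toConvTsirelson]
    exact hasCompetingFamilies_convTsirelsonNorm p D M
  · rw [← norm_ne_zero_iff, norm_toDualConvTsirelson_single, abs_one]
    exact one_ne_zero
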